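/- Let $D^3\subset\mathbb{R}^3$ be the open unit ball with the Klein model metric of hyperbolic 3-space, $\overline{D^3}=D^3\cup S^2_\infty$ the closed ball, and $\pi(x_1,\dots,x_4)=\frac1{x_4}(x_1,x_2,x_3)$ the radial projection from Minkowski space $\mathbb{E}^{3,1}$. For $v_0,\dots,v_3\in D^3$, let $u_i$ be the point of the hyperboloid $\{\langle x,x\rangle=-1,\ x_4>0\}$ with $\pi(u_i)=v_i$; the straight $3$-simplex with vertices $v_i$ is the map $\Delta^3\to D^3$, $x\mapsto\pi(\sum_i x_iu_i)$. A straight ideal $3$-simplex with vertices $v_0,\dots,v_3\in S^2_\infty$ is a map $\Delta^3\to\overline{D^3}$ of the same form, for some $u_i$ in the positive light cone $\{\langle x,x\rangle=0,\ x_4>0\}$ with $\pi(u_i)=v_i$. Straight simplices may be flat. **Proposition (Thurston's spinning construction).** Let $M$ be a closed hyperbolic $3$-manifold, with universal covering $p\colon\widetilde M=D^3\to M$, where $\widetilde M$ is identified with $D^3$ using the hyperbolic metric (so $p$ is locally isometric and $\pi_1(M)$ acts on $D^3$ by deck transformations, which are isometries and extend to $\overline{D^3}$). Let $\mathcal T$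 be a (possibly semi-simplicial) triangulation of $M$, that is, an identification of $M$ with the quotient of finitely many standard $3$-simplices by face pairings, and let $\widetilde{\mathcal T}$ be the induced triangulation of $\widetilde M$. Suppose that every edge of $\mathcal T$ is essential, i.e. is not a null-homotopic loop in $M$. Then there are a continuous family of piecewise smooth, $\pi_1(M)$-equivariant maps $\widetilde F_t\colon\widetilde M\to D^3$, $t\in[0,\infty)$, and a continuous, piecewise smooth, $\pi_1(M)$-equivariant map $\widetilde F_\infty\colon\widetilde M\to\overline{D^3}$ (piecewise smooth meaning smooth in the affine coordinates of each closed $3$-simplex) such that 1. for each vertex $\widetilde v$ of $\widetilde{\mathcal T}$, $\widetilde F_t(\widetilde v)$ approaches $S^2_\infty$ as $t\to\infty$, and for each $3$-simplex $\widetilde\sigma$ of $\widetilde{\mathcal T}$ and each $t$, $\widetilde F_t|_{\widetilde\sigma}$ is a straight hyperbolic $3$-simplex with four distinct vertices; 2. for each $t\in[0,\infty)$, $\widetilde F_t$ descends to a piecewise smooth map $F_t\colon M\to M$ which is homotopic to the identity map of $M$; 3. $\widetilde F_\infty=\lim_{t\to\infty}\widetilde F_t$ pointwise in $\overline{D^3}$;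 4. for every $3$-simplex $\widetilde\sigma$ of $\widetilde{\mathcal T}$, $\widetilde F_\infty|_{\widetilde\sigma}$ is a straight ideal $3$-simplex with four distinct vertices in $S^2_\infty$; 5. $\widetilde F_\infty(\widetilde M\setminus p^{-1}(M^{(0)}))\subset D^3$, and $\widetilde F_\infty|_{\widetilde M\setminus p^{-1}(M^{(0)})}$ descends to a continuous, piecewise smooth map $F_\infty\colon M\setminus M^{(0)}\to M$. -/

import Mathlib

open scoped NNReal unitInterval Topology ContDiff

noncomputable section

namespace Spinning

/-! ### Minkowski space and the Klein model of hyperbolic 3-space -/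

/-- Euclidean 3-space. -/
abbrev E3 : Type := EuclideanSpace ℝ (Fin 3)

/-- Minkowski space of signature (3,1): a space vector together with the last coordinate. -/
abbrev Mink : Type := E3 × ℝ

/-- The Minkowski inner product `x₁y₁ + x₂y₂ + x₃y₃ - x₄y₄`. -/
def minkForm (x y : Mink) : ℝ := inner ℝ x.1 y.1 - x.2 * y.2

/-- The hyperboloid model. -/
def hyperboloid : Set Mink := {x | minkForm x x = -1 ∧ 0 < x.2}

/-- The (positive) light cone. -/
def lightCone : Set Mink := {x | minkForm x x = 0 ∧ 0 < x.2}

/-- The radial projection, with `E3` identified with the slice at height one. -/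
def radialProj (x : Mink) : E3 := x.2⁻¹ • x.1

/-- The Klein model of hyperbolic 3-space: the open unit ball. Its topology is the Euclidean one;
its hyperbolic distance is `hypDist` below (not the Euclidean `dist` of the subtype). -/
abbrev Klein : Type := Metric.ball (0 : E3) 1

/-- The compactification of the Klein model by the sphere at infinity: the closed unit ball. -/
abbrev ClosedKlein : Type := Metric.closedBall (0 : E3) 1

/-- The point of the hyperboloid lying over a point of the Klein model. -/
def toHyperboloid (v : Klein) : Mink :=
  (Real.sqrt (1 - ‖(v : E3)‖ ^ 2))⁻¹ • ((v : E3), (1 : ℝ))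

/-- Being the inverse of the radial projection from the hyperboloid. -/
theorem toHyperboloid_spec (v : Klein) :
    toHyperboloid v ∈ hyperboloid ∧ radialProj (toHyperboloid v) = v := by
  have h1 : ‖(v : E3)‖ < 1 := mem_ball_zero_iff.1 v.2
  have h2 : 0 < 1 - ‖(v : E3)‖ ^ 2 := by nlinarith [norm_nonneg (v : E3)]
  have h3 : 0 < Real.sqrt (1 - ‖(v : E3)‖ ^ 2) := Real.sqrt_pos.2 h2
  refine ⟨⟨?_, ?_⟩, ?_⟩
  · simp only [minkForm, toHyperboloid, Prod.smul_mk, inner_smul_left, inner_smul_right,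
      real_inner_self_eq_norm_sq, smul_eq_mul, mul_one]
    have h4 := Real.sq_sqrt h2.le
    simp only [conj_trivial]
    field_simp
    linarith
  · simpa [toHyperboloid] using h3
  · simp only [radialProj, toHyperboloid, Prod.smul_mk, smul_eq_mul, mul_one, inv_inv, smul_smul]
    rw [mul_inv_cancel₀ h3.ne', one_smul]

/-- The hyperbolic distance on the Klein model: `cosh d(v,w) = -⟨u,u'⟩` for the points `u, u'` of
the hyperboloid over `v, w`. -/
def hypDist (v w : Klein) : ℝ := Real.arcosh (-minkForm (toHyperboloid v) (toHyperboloid w))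

/-! ### Straight simplices -/

/-- The standard 3-simplex. -/
abbrev Tet : Type := stdSimplex ℝ (Fin 4)

/-- The map `s` is the straightening map (straight 3-simplex) with vertices `v`. -/
def IsStraightSimplex (v : Fin 4 → Klein) (s : Tet → Klein) : Prop :=
  ∀ x : Tet, (s x : E3) = radialProj (∑ k, x k • toHyperboloid (v k))

/-- The map `s` is a straight ideal 3-simplex with vertices `v`: the projection of an affine simplex
whose vertices `u k` lie on the light cone, over the points `v k` of the sphere at infinity. -/
def IsStraightIdealSimplex (v : Fin 4 → ClosedKlein) (s : Tet → ClosedKlein) : Prop :=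
  ∃ u : Fin 4 → Mink, (∀ k, u k ∈ lightCone ∧ radialProj (u k) = v k) ∧
    ∀ x : Tet, (s x : E3) = radialProj (∑ k, x k • u k)

/-! ### Closed hyperbolic 3-manifolds -/

/-- The map `p` is a universal covering of the metric space `M` by hyperbolic 3-space which is
locally isometric for the hyperbolic distance. -/
structure IsHyperbolicCover {M : Type*} [MetricSpace M] (p : Klein → M) : Prop where
  isCoveringMap : IsCoveringMap p
  surjective : Function.Surjective p
  locally_isometric : ∀ x : Klein, ∃ U ∈ 𝓝 x, ∀ y ∈ U, ∀ z ∈ U, dist (p y) (p z) = hypDist y z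

/-- Deck transformations of `p`; for a universal covering they form the fundamental group of the
base, acting on the covering space. -/
def IsDeck {M : Type*} (p : Klein → M) (g : Klein ≃ₜ Klein) : Prop := ∀ x, p (g x) = p x

/-- The homeomorphism `G` of the compactification extends the homeomorphism `g` of the Klein model.
Such a `G` is unique, as the open ball is dense in the closed ball. -/
def Extends (G : ClosedKlein ≃ₜ ClosedKlein) (g : Klein ≃ₜ Klein) : Prop :=
  ∀ x : Klein, (G ⟨x, Metric.ball_subset_closedBall x.2⟩ : E3) = g x

/-! ### Semi-simplicial triangulations -/

/-- Face pairings of `n` tetrahedra. The `k`-th face (opposite to vertex `k`) of tetrahedron `i` is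
paired with the face opposite to vertex `perm i k k` of tetrahedron `adj i k`, the vertex `m ≠ k` of
the former corresponding to the vertex `perm i k m` of the latter. The pairing is a fixed point free
involution on the set of all faces. -/
structure FacePairing (n : ℕ) where
  adj : Fin n → Fin 4 → Fin n
  perm : Fin n → Fin 4 → Equiv.Perm (Fin 4)
  adj_adj : ∀ i k, adj (adj i k) (perm i k k) = i
  perm_perm : ∀ i k, perm (adj i k) (perm i k k) = (perm i k)⁻¹
  not_self : ∀ i k, ¬ (adj i k = i ∧ perm i k k = k)

/-- A point of the `k`-th face of a tetrahedron is related to its image under the isometry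
which pairs this face with another one. -/
def FacePairing.Rel {n : ℕ} (Φ : FacePairing n) (a b : Fin n × Tet) : Prop :=
  ∃ k : Fin 4, a.2 k = 0 ∧ b.1 = Φ.adj a.1 k ∧ ∀ m, b.2 (Φ.perm a.1 k m) = a.2 m

/-- A triangulation (possibly semi-simplicial, i.e. singular) of a closed 3-manifold `M`: an
identification of `M` with a finite disjoint union of standard 3-simplices modulo face pairings. -/
structure Triangulation (M : Type*) [TopologicalSpace M] where
  n : ℕ
  pairing : FacePairing n
  homeo : Quot pairing.Rel ≃ₜ M

namespace Triangulation

variable {M : Type*} [TopologicalSpace M] (T : Triangulation M)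

/-- The characteristic map of the `i`-th 3-simplex. -/
def char (i : Fin T.n) : C(Tet, M) where
  toFun x := T.homeo (Quot.mk _ (i, x))
  continuous_toFun := T.homeo.continuous.comp
    (continuous_quot_mk.comp (continuous_const.prodMk continuous_id))

/-- The 0-skeleton. -/
def vertices : Set M := {m | ∃ i k, m = T.char i (stdSimplex.vertex k)}

/-- The lifts of the `i`-th 3-simplex with respect to `p`. When `p` is the universal covering, these
are the 3-simplices of the induced triangulation of the universal cover. -/
def IsLift (p : Klein → M) (i : Fin T.n) (s : C(Tet, Klein)) : Prop :=
  ∀ x, p (s x) = T.char i x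

end Triangulation

/-- The affine path from vertex `a` to vertex `b` of the standard 3-simplex. -/
def stdEdge (a b : Fin 4) : Path (stdSimplex.vertex a : Tet) (stdSimplex.vertex b) where
  toFun s := ⟨AffineMap.lineMap (stdSimplex.vertex a : Tet).1 (stdSimplex.vertex b : Tet).1 (s : ℝ),
    (convex_stdSimplex ℝ (Fin 4)).lineMap_mem (stdSimplex.vertex a : Tet).2
      (stdSimplex.vertex b : Tet).2 s.2⟩
  continuous_toFun := by
    refine Continuous.subtype_mk ?_ _
    exact AffineMap.lineMap_continuous.comp continuous_subtype_val
  source' := by ext; simp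
  target' := by ext; simp

namespace Triangulation

variable {M : Type*} [TopologicalSpace M] (T : Triangulation M)

/-- The edge of `M` coming from the edge `ab` of the `i`-th 3-simplex, as a path in `M`. -/
def edge (i : Fin T.n) (a b : Fin 4) :
    Path (T.char i (stdSimplex.vertex a)) (T.char i (stdSimplex.vertex b)) :=
  (stdEdge a b).map (T.char i).continuous

/-- All edges are essential: none of them is a null-homotopic loop in `M`. -/
def EdgesEssential : Prop :=
  ∀ (i : Fin T.n) (a b : Fin 4), a ≠ b →
    ∀ h : T.char i (stdSimplex.vertex a) = T.char i (stdSimplex.vertex b),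
      ¬ ((T.edge i a b).cast rfl h).Homotopic (Path.refl _)

end Triangulation

/-! ### Piecewise smooth maps

Piecewise smooth means smooth in the affine coordinates of every closed 3-simplex. -/

/-- Smoothness on a subset `S` of the standard 3-simplex of a map to Euclidean 3-space. -/
def SmoothOn (S : Set Tet) (f : Tet → E3) : Prop :=
  ∃ h : (Fin 4 → ℝ) → E3, ContDiffOn ℝ ∞ h (Subtype.val '' S) ∧ ∀ x ∈ S, h x.1 = f x

/-- Smoothness on a subset `S` of the standard 3-simplex of a map to a manifold with universal
covering `p`, for the smooth structure that makes `p` a local diffeomorphism: the map has smooth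
local lifts. -/
def SmoothInto {M : Type*} (p : Klein → M) (S : Set Tet) (f : Tet → M) : Prop :=
  ∀ x ∈ S, ∃ U ∈ 𝓝 x, ∃ h : Tet → Klein,
    SmoothOn (U ∩ S) (fun y => (h y : E3)) ∧ ∀ y ∈ U ∩ S, p (h y) = f y

section

variable {M : Type*} [TopologicalSpace M] (T : Triangulation M)

/-- Piecewise smooth maps from the universal cover to Euclidean 3-space. -/
def PiecewiseSmooth (p : Klein → M) (F : Klein → E3) : Prop :=
  ∀ (i : Fin T.n) (s : C(Tet, Klein)), T.IsLift p i s → SmoothOn Set.univ (fun x => F (s x))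

/-- Piecewise smooth maps from a subset `N` of `M` to `M`. -/
def PiecewiseSmoothInto (p : Klein → M) (N : Set M) (f : M → M) : Prop :=
  ∀ i : Fin T.n, SmoothInto p (T.char i ⁻¹' N) (fun x => f (T.char i x))

end

end Spinning

end

/-!
Deck transformations of the hyperbolic universal covering `p : Klein → M` are locally isometric,
so each of them is the restriction of a linear Lorentz transformation (`exists_lorentz`). A point
of the hyperboloid can therefore be attached equivariantly to the vertices of the induced
triangulation, extended affinely in Minkowski space over every lifted simplex (`linearExt`), and
projected back to the Klein model. The extension is well defined because lifts of paired faces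
agree (`lift_face_eq`), it is equivariant because the action is linear, and it is continuous
because continuity can be tested on the lifted simplices (`continuous_of_lifts`).

The spinning consists in the choice of the points attached to the vertices. There is an
equivariant map `φ` to the deck group which takes distinct values at the vertices of every lifted
simplex (`exists_marking`). For two lifts of one vertex of `M` this holds automatically, since
essential edges lift to edges with distinct ends. Lifts of different vertices can be separated
because the deck group is infinite, and only finitely many quotients of marks along edges have to
be avoided. The vertex `v` is then sent to `φ(v) o_t`, where `o_t` runs along a ray to a point `ξ`
at infinity. These images are distinct on every simplex as the action is free. Their limits `φ(v)
ξ` are distinct if `ξ` is fixed by none of the finitely many nontrivial elements `φ(v)⁻¹ φ(w)`,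
for edges `vw`. Such a `ξ` exists, since a nontrivial deck transformation has at most two fixed
points at infinity (`finite_fixed_ideal_points`).

All vectors attached to the vertices at time `t` are images of one vector over `o_t`, so dividing
by its height makes them converge to the null vectors `φ(v) (ξ, 1)` simultaneously. This gives the
limit map, whose simplices are straight ideal simplices. A combination of at least two distinct
null directions is timelike (`sum_lightCone_mem_futureCone`), hence only vertices go to infinity.
Equivariant maps are homotopic to the identity along geodesics, which are projections of segments
in Minkowski space (`exists_descent`).
-/

noncomputable section

namespace Spinning

/-! ### Minkowski geometry -/

/-- The Minkowski inner product as a bilinear map. -/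
def minkBilin : Mink →ₗ[ℝ] Mink →ₗ[ℝ] ℝ :=
  LinearMap.mk₂ ℝ minkForm
    (fun x y z => by simp only [minkForm, Prod.fst_add, Prod.snd_add, inner_add_left]; ring)
    (fun c x y => by
      simp only [minkForm, Prod.smul_fst, Prod.smul_snd, real_inner_smul_left, smul_eq_mul]; ring)
    (fun x y z => by simp only [minkForm, Prod.fst_add, Prod.snd_add, inner_add_right]; ring)
    (fun c x y => by
      simp only [minkForm, Prod.smul_fst, Prod.smul_snd, real_inner_smul_right, smul_eq_mul]; ring)

theorem minkBilin_apply (x y : Mink) : minkBilin x y = minkForm x y := rfl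

theorem minkForm_self (x : Mink) : minkForm x x = ‖x.1‖ ^ 2 - x.2 ^ 2 := by
  simp only [minkForm, real_inner_self_eq_norm_sq]; ring

theorem eq_zero_of_minkForm_eq_zero {x : Mink} (h : ∀ y, minkForm x y = 0) : x = 0 := by
  have h1 := h (x.1, -x.2)
  simp only [minkForm, real_inner_self_eq_norm_sq] at h1
  have h2 : ‖x.1‖ ^ 2 = 0 := by nlinarith [sq_nonneg ‖x.1‖, sq_nonneg x.2]
  have h3 : x.2 ^ 2 = 0 := by nlinarith [sq_nonneg ‖x.1‖, sq_nonneg x.2]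
  exact Prod.ext (by simpa using h2) (by simpa using h3)

/-- The open future cone, consisting of the future directed timelike vectors. -/
def futureCone : Set Mink := {x | ‖x.1‖ < x.2}

theorem pos_of_mem_futureCone {x : Mink} (hx : x ∈ futureCone) : 0 < x.2 :=
  (norm_nonneg _).trans_lt hx

theorem mem_futureCone_of_mem_hyperboloid {x : Mink} (hx : x ∈ hyperboloid) : x ∈ futureCone := by
  have h := hx.1
  rw [minkForm_self] at h
  exact lt_of_pow_lt_pow_left₀ 2 hx.2.le (by linarith)

theorem norm_eq_of_mem_lightCone {x : Mink} (hx : x ∈ lightCone) : ‖x.1‖ = x.2 := by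
  have h := hx.1
  rw [minkForm_self] at h
  exact (sq_eq_sq₀ (norm_nonneg _) hx.2.le).1 (by linarith)

theorem toHyperboloid_mem_futureCone (v : Klein) : toHyperboloid v ∈ futureCone :=
  mem_futureCone_of_mem_hyperboloid (toHyperboloid_spec v).1

theorem norm_radialProj {x : Mink} (hx : 0 < x.2) : ‖radialProj x‖ = ‖x.1‖ / x.2 := by
  rw [radialProj, norm_smul, norm_inv, Real.norm_of_nonneg hx.le, div_eq_inv_mul]

theorem radialProj_mem_ball {x : Mink} (hx : x ∈ futureCone) :
    radialProj x ∈ Metric.ball (0 : E3) 1 := by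
  have h := pos_of_mem_futureCone hx
  rw [mem_ball_zero_iff, norm_radialProj h, div_lt_one h]
  exact hx

theorem norm_radialProj_of_mem_lightCone {x : Mink} (hx : x ∈ lightCone) :
    ‖radialProj x‖ = 1 := by
  rw [norm_radialProj hx.2, norm_eq_of_mem_lightCone hx, div_self hx.2.ne']

theorem radialProj_mem_closedBall {x : Mink} (hx : ‖x.1‖ ≤ x.2) :
    radialProj x ∈ Metric.closedBall (0 : E3) 1 := by
  rw [mem_closedBall_zero_iff]
  rcases ((norm_nonneg _).trans hx).eq_or_lt with h | h
  · simp [radialProj, ← h]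
  · rwa [norm_radialProj h, div_le_one h]

theorem radialProj_smul {c : ℝ} (hc : c ≠ 0) (x : Mink) : radialProj (c • x) = radialProj x := by
  simp only [radialProj, Prod.smul_fst, Prod.smul_snd, smul_smul, smul_eq_mul, mul_inv]
  congr 1
  field_simp

theorem smul_radialProj {x : Mink} (hx : x.2 ≠ 0) : x.2 • ((radialProj x, 1) : Mink) = x := by
  refine Prod.ext ?_ ?_
  · simp [radialProj, smul_smul, hx]
  · simp

theorem radialProj_mk_one (v : E3) : radialProj (v, 1) = v := by simp [radialProj]

theorem continuousOn_radialProj : ContinuousOn radialProj {x | x.2 ≠ 0} :=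
  (continuousOn_snd.inv₀ fun _ h => h).smul continuousOn_fst

theorem continuousAt_radialProj {x : Mink} (hx : 0 < x.2) : ContinuousAt radialProj x :=
  (continuousAt_snd.inv₀ hx.ne').smul continuousAt_fst

theorem continuous_toHyperboloid : Continuous toHyperboloid := by
  have h0 : Continuous fun v : Klein => Real.sqrt (1 - ‖(v : E3)‖ ^ 2) := by fun_prop
  have h2 : Continuous fun v : Klein => (((v : E3), (1 : ℝ)) : Mink) := by fun_prop
  refine (h0.inv₀ fun v => ?_).smul h2
  have h1 : ‖(v : E3)‖ < 1 := mem_ball_zero_iff.1 v.2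
  exact (Real.sqrt_pos.2 (by nlinarith [norm_nonneg (v : E3)])).ne'

theorem convex_futureCone : Convex ℝ futureCone := by
  have h : futureCone = {x : Mink | x ∈ Set.univ ∧ ‖x.1‖ - x.2 < 0} := by
    ext x; simp [futureCone]
  rw [h]
  refine ConvexOn.convex_lt ?_ 0
  exact (convexOn_univ_norm.comp_linearMap (LinearMap.fst ℝ E3 ℝ)).sub
    ((LinearMap.snd ℝ E3 ℝ).concaveOn convex_univ)

/-- A causal vector (`‖x.1‖ ≤ |x.2|`) having negative product with a future directed timelike one
is future directed. -/
theorem pos_of_minkForm_neg {x u : Mink} (hu : u ∈ futureCone) (hx : ‖x.1‖ ≤ |x.2|)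
    (h : minkForm x u < 0) : 0 < x.2 := by
  by_contra! h0
  rw [abs_of_nonpos h0] at hx
  have h1 := neg_le_of_abs_le (abs_real_inner_le_norm x.1 u.1)
  have hu' : ‖u.1‖ < u.2 := hu
  have h2 : ‖x.1‖ * ‖u.1‖ ≤ -x.2 * u.2 :=
    mul_le_mul hx hu'.le (norm_nonneg _) (by linarith)
  simp only [minkForm] at h
  linarith

theorem minkForm_neg {x u : Mink} (hu : u ∈ futureCone) (hx : ‖x.1‖ ≤ x.2) (h0 : 0 < x.2) :
    minkForm x u < 0 := by
  have h1 := (abs_le.1 (abs_real_inner_le_norm x.1 u.1)).2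
  have hu' : ‖u.1‖ < u.2 := hu
  have h2 : ‖x.1‖ * ‖u.1‖ ≤ x.2 * ‖u.1‖ := mul_le_mul_of_nonneg_right hx (norm_nonneg _)
  have h3 : x.2 * ‖u.1‖ < x.2 * u.2 := mul_lt_mul_of_pos_left hu' h0
  simp only [minkForm]
  linarith

/-- The reversed Cauchy-Schwarz inequality. -/
theorem one_le_neg_minkForm (v w : Klein) :
    1 ≤ -minkForm (toHyperboloid v) (toHyperboloid w) := by
  set x := toHyperboloid v with hx
  set y := toHyperboloid w with hy
  have h1 := (toHyperboloid_spec v).1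
  have h2 := (toHyperboloid_spec w).1
  rw [← hx] at h1
  rw [← hy] at h2
  have e1 := h1.1
  have e2 := h2.1
  rw [minkForm_self] at e1 e2
  have h3 := (abs_le.1 (abs_real_inner_le_norm x.1 y.1)).2
  have h4 : 1 + ‖x.1‖ * ‖y.1‖ ≤ x.2 * y.2 := by
    apply le_of_sq_le_sq _ (mul_nonneg h1.2.le h2.2.le)
    have e3 : x.2 ^ 2 = 1 + ‖x.1‖ ^ 2 := by linarith
    have e4 : y.2 ^ 2 = 1 + ‖y.1‖ ^ 2 := by linarith
    rw [mul_pow, e3, e4]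
    nlinarith [sq_nonneg (‖x.1‖ - ‖y.1‖)]
  simp only [minkForm]
  linarith

/-- The point of the Klein model below a vector of the open future cone (and the centre below any
other vector). -/
def toKlein (x : Mink) : Klein :=
  open Classical in
  if h : radialProj x ∈ Metric.ball (0 : E3) 1 then ⟨radialProj x, h⟩
  else ⟨0, Metric.mem_ball_self one_pos⟩

theorem coe_toKlein {x : Mink} (hx : x ∈ futureCone) : (toKlein x : E3) = radialProj x := by
  rw [toKlein, dif_pos (radialProj_mem_ball hx)]

theorem toKlein_toHyperboloid (v : Klein) : toKlein (toHyperboloid v) = v :=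
  Subtype.ext ((coe_toKlein (toHyperboloid_mem_futureCone v)).trans (toHyperboloid_spec v).2)

theorem isOpen_futureCone : IsOpen futureCone :=
  isOpen_lt (continuous_fst.norm) continuous_snd

theorem continuousOn_toKlein : ContinuousOn toKlein futureCone := by
  rw [continuousOn_iff_continuous_domRestrict]
  refine Continuous.subtype_mk (f := fun x : futureCone => radialProj x) ?_
    (fun x => radialProj_mem_ball x.2) |>.congr fun x => Subtype.ext (coe_toKlein x.2).symm
  exact (continuousOn_radialProj.mono fun x hx => (pos_of_mem_futureCone hx).ne').domRestrict

/-- The positive multiple of a timelike vector which lies on the hyperboloid. -/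
theorem toHyperboloid_toKlein {x : Mink} (hx : x ∈ futureCone) :
    ∃ c : ℝ, 0 < c ∧ toHyperboloid (toKlein x) = c • x := by
  have h := pos_of_mem_futureCone hx
  have h1 : ‖(toKlein x : E3)‖ < 1 := mem_ball_zero_iff.1 (toKlein x).2
  have h2 : 0 < Real.sqrt (1 - ‖(toKlein x : E3)‖ ^ 2) :=
    Real.sqrt_pos.2 (by nlinarith [norm_nonneg (toKlein x : E3)])
  refine ⟨(Real.sqrt (1 - ‖(toKlein x : E3)‖ ^ 2))⁻¹ * x.2⁻¹, by positivity, ?_⟩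
  nth_rewrite 4 [← smul_radialProj h.ne']
  rw [smul_smul, mul_assoc, inv_mul_cancel₀ h.ne', mul_one, toHyperboloid, coe_toKlein hx]

theorem toKlein_smul {c : ℝ} (hc : 0 < c) {x : Mink} : toKlein (c • x) = toKlein x := by
  unfold toKlein
  have h := radialProj_smul hc.ne' x
  split_ifs with h1 h2 h2
  · exact Subtype.ext h
  · exact absurd (h ▸ h1) h2
  · exact absurd (h.symm ▸ h2) h1
  · rfl

/-- A combination of distinct future null directions which involves at least two of them is
timelike. -/
theorem sum_lightCone_mem_futureCone {u : Fin 4 → Mink} (hu : ∀ k, u k ∈ lightCone)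
    (hinj : Function.Injective fun k => radialProj (u k)) {a : Tet}
    (ha : ∀ k, a ≠ stdSimplex.vertex k) : ∑ k, a k • u k ∈ futureCone := by
  have hpos : ∀ k, 0 ≤ a k := a.2.1
  have hsum : ∑ k, a k = 1 := a.2.2
  obtain ⟨k, hk⟩ : ∃ k, a k ≠ 0 := by
    by_contra! h
    simp [h] at hsum
  obtain ⟨m, hmk, hm⟩ : ∃ m, m ≠ k ∧ a m ≠ 0 := by
    by_contra! h
    refine ha k (stdSimplex.ext (funext fun m => ?_))
    change a m = (Pi.single k (1 : ℝ) : Fin 4 → ℝ) m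
    by_cases hmk : m = k
    · rw [Finset.sum_eq_single k (fun m _ hm => h m hm) (by simp)] at hsum
      rw [hmk, hsum, Pi.single_eq_same]
    · rw [h m hmk, Pi.single_eq_of_ne hmk]
  have hk' : 0 < a k := lt_of_le_of_ne (hpos k) hk.symm
  have hm' : 0 < a m := lt_of_le_of_ne (hpos m) hm.symm
  have hlt : ‖a k • (u k).1 + a m • (u m).1‖ < ‖a k • (u k).1‖ + ‖a m • (u m).1‖ := by
    refine norm_add_lt_of_not_sameRay fun hray => hmk ?_
    have h1 : SameRay ℝ (u k).1 (u m).1 := by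
      have := (hray.pos_smul_left (inv_pos.2 hk')).pos_smul_right (inv_pos.2 hm')
      rwa [inv_smul_smul₀ hk'.ne', inv_smul_smul₀ hm'.ne'] at this
    have hne : ∀ j, (u j).1 ≠ 0 := fun j h0 => by
      have := norm_eq_of_mem_lightCone (hu j)
      rw [h0, norm_zero] at this
      exact (hu j).2.ne this
    have h2 := (sameRay_iff_inv_norm_smul_eq_of_ne (hne k) (hne m)).1 h1
    rw [norm_eq_of_mem_lightCone (hu k), norm_eq_of_mem_lightCone (hu m)] at h2
    exact (hinj h2).symm
  have hnorm : ∀ j, ‖a j • (u j).1‖ = a j * (u j).2 := fun j => by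
    rw [norm_smul, Real.norm_of_nonneg (hpos j), norm_eq_of_mem_lightCone (hu j)]
  change ‖(∑ k, a k • u k).1‖ < (∑ k, a k • u k).2
  have hm_mem : m ∈ Finset.univ.erase k := Finset.mem_erase.2 ⟨hmk, Finset.mem_univ m⟩
  rw [Prod.fst_sum, Prod.snd_sum, ← Finset.add_sum_erase _ _ (Finset.mem_univ k),
    ← Finset.add_sum_erase _ _ hm_mem, ← add_assoc,
    ← Finset.add_sum_erase _ (fun k => (a k • u k).2) (Finset.mem_univ k),
    ← Finset.add_sum_erase _ (fun k => (a k • u k).2) hm_mem, ← add_assoc]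
  refine lt_of_le_of_lt (norm_add_le _ _) (add_lt_add_of_lt_of_le ?_ ?_)
  · rw [hnorm, hnorm] at hlt
    exact hlt
  · exact (norm_sum_le _ _).trans (Finset.sum_le_sum fun j _ => (hnorm j).le)

/-! ### Lorentz transformations -/

/-- The points of the hyperboloid over a nonempty open subset of the Klein model span Minkowski
space. -/
theorem span_toHyperboloid_image {U : Set Klein} (hU : IsOpen U) (hne : U.Nonempty) :
    Submodule.span ℝ (toHyperboloid '' U) = ⊤ := by
  obtain ⟨x, hx⟩ := hne
  set S := Submodule.span ℝ (toHyperboloid '' U)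
  have key : ∀ v ∈ U, (((v : E3), (1 : ℝ)) : Mink) ∈ S := by
    intro v hv
    have h1 := S.smul_mem (toHyperboloid v).2⁻¹ (Submodule.subset_span ⟨v, hv, rfl⟩)
    have h2 := (toHyperboloid_spec v).1.2
    have h3 := smul_radialProj h2.ne'
    rw [(toHyperboloid_spec v).2] at h3
    rwa [← h3, smul_smul, Prod.smul_snd, smul_eq_mul, mul_one, inv_mul_cancel₀ h2.ne',
      one_smul] at h1
  have hU' : IsOpen (Subtype.val '' U : Set E3) := Metric.isOpen_ball.isOpenMap_subtype_val U hU
  have key2 : ∀ w : E3, ((w, (0 : ℝ)) : Mink) ∈ S := by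
    intro w
    have h1 : ∀ᶠ c : ℝ in 𝓝 0, (x : E3) + c • w ∈ (Subtype.val '' U : Set E3) := by
      have : ContinuousAt (fun c : ℝ => (x : E3) + c • w) 0 := by fun_prop
      refine this.eventually_mem (hU'.mem_nhds ?_)
      rw [zero_smul, add_zero]
      exact ⟨x, hx, rfl⟩
    obtain ⟨c, hc, hc0⟩ := ((h1.filter_mono nhdsWithin_le_nhds).and
      (self_mem_nhdsWithin : {(0 : ℝ)}ᶜ ∈ 𝓝[≠] 0)).exists
    obtain ⟨y, hy, hyw⟩ := hc
    have h2 := S.smul_mem c⁻¹ (S.sub_mem (key y hy) (key x hx))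
    have hc0 : c ≠ 0 := hc0
    simpa [hyw, smul_smul, hc0] using h2
  rw [eq_top_iff]
  rintro y -
  have h1 := S.add_mem (S.smul_mem y.2 (key x hx)) (key2 (y.1 - y.2 • (x : E3)))
  have h2 : y.2 • (((x : E3), (1 : ℝ)) : Mink) + (y.1 - y.2 • (x : E3), 0) = y := by
    ext <;> simp
  rwa [h2] at h1

/-- Linear extension of isometries: a map which preserves the products of the points over an open
set comes from a linear Lorentz transformation. -/
theorem exists_lorentz_of_local {g : Klein → Klein} {U : Set Klein} (hU : IsOpen U)
    (hne : U.Nonempty)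
    (h : ∀ x ∈ U, ∀ y ∈ U, minkForm (toHyperboloid (g x)) (toHyperboloid (g y)) =
      minkForm (toHyperboloid x) (toHyperboloid y)) :
    ∃ A : Mink →ₗ[ℝ] Mink, (∀ x y, minkForm (A x) (A y) = minkForm x y) ∧
      ∀ x ∈ U, A (toHyperboloid x) = toHyperboloid (g x) := by
  have hs := (span_toHyperboloid_image hU hne).ge
  let b := Module.Basis.ofSpan hs
  have hb : ∀ i, ∃ x ∈ U, toHyperboloid x = b i := fun i =>
    Module.Basis.ofSpan_subset hs ⟨i, rfl⟩
  choose x hxU hx using hb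
  let A : Mink →ₗ[ℝ] Mink := b.constr ℝ fun i => toHyperboloid (g (x i))
  have hA : ∀ i, A (b i) = toHyperboloid (g (x i)) := fun i => b.constr_basis ℝ _ i
  have hform : ∀ y z, minkForm (A y) (A z) = minkForm y z := by
    have : minkBilin.compl₁₂ A A = minkBilin := by
      refine b.ext fun i => b.ext fun j => ?_
      simp only [LinearMap.compl₁₂_apply, minkBilin_apply, hA, h _ (hxU i) _ (hxU j), hx]
    intro y z
    exact congrArg (fun B : Mink →ₗ[ℝ] Mink →ₗ[ℝ] ℝ => B y z) this
  have hinj : Function.Injective A := by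
    rw [← LinearMap.ker_eq_bot, LinearMap.ker_eq_bot']
    intro y hy
    refine eq_zero_of_minkForm_eq_zero fun z => ?_
    rw [← hform, hy, ← minkBilin_apply, map_zero, LinearMap.zero_apply]
  -- As `A` is onto and the form is nondegenerate, `A u` is determined by its products with the
  -- images of the basis, which are the prescribed ones.
  have hsurj : Function.Surjective A := LinearMap.injective_iff_surjective.1 hinj
  refine ⟨A, hform, fun y hy => ?_⟩
  rw [← sub_eq_zero]
  refine eq_zero_of_minkForm_eq_zero fun z => ?_
  obtain ⟨w, rfl⟩ := hsurj z
  rw [← minkBilin_apply, map_sub, LinearMap.sub_apply, minkBilin_apply, minkBilin_apply, hform,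
    sub_eq_zero]
  have : minkBilin (toHyperboloid y) = (minkBilin (toHyperboloid (g y))) ∘ₗ A := by
    refine b.ext fun i => ?_
    rw [LinearMap.comp_apply, minkBilin_apply, minkBilin_apply, hA, h _ hy _ (hxU i), ← hx]
  exact congrArg (fun B : Mink →ₗ[ℝ] ℝ => B w) this

theorem lorentz_ext {A B : Mink →ₗ[ℝ] Mink} {U : Set Klein} (hU : IsOpen U) (hne : U.Nonempty)
    (h : ∀ x ∈ U, A (toHyperboloid x) = B (toHyperboloid x)) : A = B := by
  refine LinearMap.ext_on (span_toHyperboloid_image hU hne) ?_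
  rintro _ ⟨x, hx, rfl⟩
  exact h x hx

instance : PreconnectedSpace Klein :=
  Subtype.preconnectedSpace (convex_ball (0 : E3) 1).isPreconnected

theorem minkForm_eq_of_hypDist_eq {v w v' w' : Klein} (h : hypDist v w = hypDist v' w') :
    minkForm (toHyperboloid v) (toHyperboloid w) =
      minkForm (toHyperboloid v') (toHyperboloid w') :=
  neg_injective (Real.arcosh_injOn (one_le_neg_minkForm v w) (one_le_neg_minkForm v' w') h)

/-- Deck transformations of a locally isometric covering are restrictions of linear Lorentz
transformations: this holds locally, and the local transformations agree on overlaps. -/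
theorem exists_lorentz {M : Type*} [MetricSpace M] {p : Klein → M} (hp : IsHyperbolicCover p)
    {g : Klein ≃ₜ Klein} (hg : IsDeck p g) :
    ∃ A : Mink →ₗ[ℝ] Mink, (∀ x y, minkForm (A x) (A y) = minkForm x y) ∧
      ∀ x, A (toHyperboloid x) = toHyperboloid (g x) := by
  have hloc : ∀ x, ∃ A : Mink →ₗ[ℝ] Mink, (∀ x y, minkForm (A x) (A y) = minkForm x y) ∧
      ∀ᶠ y in 𝓝 x, A (toHyperboloid y) = toHyperboloid (g y) := by
    intro x
    obtain ⟨U, hU, hUd⟩ := hp.locally_isometric x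
    obtain ⟨V, hV, hVd⟩ := hp.locally_isometric (g x)
    obtain ⟨W, hWs, hW, hxW⟩ := mem_nhds_iff.1 (Filter.inter_mem hU (g.continuous.continuousAt hV))
    obtain ⟨A, hA, hAg⟩ := exists_lorentz_of_local (g := g) hW ⟨x, hxW⟩ fun y hy z hz => by
      refine minkForm_eq_of_hypDist_eq ?_
      rw [← hUd y (hWs hy).1 z (hWs hz).1, ← hVd _ (hWs hy).2 _ (hWs hz).2, hg, hg]
    exact ⟨A, hA, Filter.mem_of_superset (hW.mem_nhds hxW) hAg⟩
  obtain ⟨A, hA, hA0⟩ := hloc ⟨0, Metric.mem_ball_self one_pos⟩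
  refine ⟨A, hA, ?_⟩
  have hclopen : IsClopen {x | ∀ᶠ y in 𝓝 x, A (toHyperboloid y) = toHyperboloid (g y)} := by
    refine ⟨isClosed_of_closure_subset fun x hx => ?_, isOpen_setOfPred_eventually_nhds⟩
    obtain ⟨B, -, hB⟩ := hloc x
    obtain ⟨W, hWs, hW, hxW⟩ := mem_nhds_iff.1 hB
    obtain ⟨y, hyW, hy⟩ := mem_closure_iff.1 hx W hW hxW
    obtain ⟨W', hWs', hW', hyW'⟩ := mem_nhds_iff.1 hy
    have : A = B := lorentz_ext (hW.inter hW') ⟨y, hyW, hyW'⟩ fun z hz =>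
      (hWs' hz.2).trans (hWs hz.1).symm
    rw [this]
    exact hB
  intro x
  have : x ∈ {x | ∀ᶠ y in 𝓝 x, A (toHyperboloid y) = toHyperboloid (g y)} := by
    rw [hclopen.eq_univ ⟨_, hA0⟩]; trivial
  exact Filter.Eventually.self_of_nhds
    (p := fun y => A (toHyperboloid y) = toHyperboloid (g y)) this

/-! ### The deck group -/

instance : SimplyConnectedSpace Klein :=
  haveI : ContractibleSpace Klein :=
    (convex_ball (0 : E3) 1).contractibleSpace ⟨0, Metric.mem_ball_self one_pos⟩
  inferInstance

instance : LocallyPathConnectedSpace Klein :=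
  Metric.isOpen_ball.locallyPathConnectedSpace

instance : SimplyConnectedSpace Tet :=
  haveI : ContractibleSpace Tet :=
    (convex_stdSimplex ℝ (Fin 4)).contractibleSpace ⟨_, single_mem_stdSimplex ℝ 0⟩
  inferInstance

instance : LocallyPathConnectedSpace Tet :=
  (convex_stdSimplex ℝ (Fin 4)).locallyPathConnectedSpace

section Deck

section Group

variable {M : Type*} {p : Klein → M}

/-- The group of deck transformations of `p`, as a subgroup of the homeomorphism group. -/
def deckGroup (p : Klein → M) : Subgroup (Klein ≃ₜ Klein) where
  carrier := {g | IsDeck p g}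
  mul_mem' := fun {g h} hg hh x => (hg (h x)).trans (hh x)
  one_mem' := fun _ => rfl
  inv_mem' := fun {g} hg x => by
    have h := hg (g⁻¹ x)
    rw [← Homeomorph.mul_apply, mul_inv_cancel] at h
    exact h.symm

theorem p_deck (g : deckGroup p) (x : Klein) : p (g.1 x) = p x := g.2 x

theorem deck_mul_apply (g h : deckGroup p) (x : Klein) : (g * h).1 x = g.1 (h.1 x) := rfl

end Group

variable {M : Type*} [MetricSpace M] {p : Klein → M}

theorem deck_ext_of_eq (hp : IsHyperbolicCover p) {g h : deckGroup p} {x : Klein}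
    (hx : g.1 x = h.1 x) : g = h := by
  have : (g.1 : Klein → Klein) = h.1 :=
    hp.isCoveringMap.eq_of_comp_eq g.1.continuous h.1.continuous
      (funext fun y => (p_deck g y).trans (p_deck h y).symm) x hx
  exact Subtype.ext (Homeomorph.ext fun y => congrFun this y)

/-- The universal covering is regular: deck transformations are obtained by lifting `p` through
itself. -/
theorem exists_deck (hp : IsHyperbolicCover p) {x y : Klein} (h : p x = p y) :
    ∃ g : deckGroup p, g.1 x = y := by
  have hc := hp.isCoveringMap
  obtain ⟨F, ⟨hF, hpF⟩, -⟩ :=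
    hc.existsUnique_continuousMap_lifts ⟨p, hc.continuous⟩ x y h.symm
  obtain ⟨G, ⟨hG, hpG⟩, -⟩ :=
    hc.existsUnique_continuousMap_lifts ⟨p, hc.continuous⟩ y x h
  have hpF' : ∀ z, p (F z) = p z := fun z => congrFun hpF z
  have hpG' : ∀ z, p (G z) = p z := fun z => congrFun hpG z
  have hGF : (G ∘ F : Klein → Klein) = id :=
    hc.eq_of_comp_eq (G.continuous.comp F.continuous) continuous_id
      (funext fun z => (hpG' (F z)).trans (hpF' z)) x (by simp [hF, hG])
  have hFG : (F ∘ G : Klein → Klein) = id :=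
    hc.eq_of_comp_eq (F.continuous.comp G.continuous) continuous_id
      (funext fun z => (hpF' (G z)).trans (hpG' z)) y (by simp [hF, hG])
  exact ⟨⟨⟨⟨F, G, congrFun hGF, congrFun hFG⟩, F.continuous, G.continuous⟩, hpF'⟩, hF⟩

theorem isOpenQuotientMap_cover (hp : IsHyperbolicCover p) : IsOpenQuotientMap p :=
  ⟨hp.surjective, hp.isCoveringMap.continuous, hp.isCoveringMap.isLocalHomeomorph.isOpenMap⟩

/-- The deck group is infinite, because the base is compact and hyperbolic space is not. -/
theorem infinite_deckGroup [CompactSpace M] (hp : IsHyperbolicCover p) :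
    Infinite (deckGroup p) := by
  rw [← not_finite_iff_infinite]
  intro hfin
  -- Some compact ball of radius `1 - 1 / (n + 1)` already covers the base.
  let r : ℕ → ℝ := fun n => 1 - 1 / ((n : ℝ) + 1)
  let U : ℕ → Set Klein := fun n => {x | ‖(x : E3)‖ < r n}
  have hr : Monotone r := fun m n h => by
    have := one_div_le_one_div_of_le (α := ℝ) (by positivity : (0 : ℝ) < m + 1)
      (by gcongr : (m : ℝ) + 1 ≤ n + 1)
    simp only [r]; linarith
  have hr1 : ∀ n, r n < 1 := fun n => sub_lt_self _ (by positivity)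
  obtain ⟨n, hn⟩ := isCompact_univ.elim_directed_cover (fun n => p '' U n)
    (fun n => (isOpenQuotientMap_cover hp).isOpenMap _
      (isOpen_lt (by fun_prop) continuous_const))
    (fun m _ => by
      obtain ⟨x, rfl⟩ := hp.surjective m
      have h1 : ‖(x : E3)‖ < 1 := mem_ball_zero_iff.1 x.2
      obtain ⟨n, hn⟩ := exists_nat_one_div_lt (sub_pos.2 h1)
      exact Set.mem_iUnion.2 ⟨n, x, by change ‖(x : E3)‖ < 1 - _; linarith, rfl⟩)
    (Monotone.directed_le fun m n h => Set.image_mono fun x hx => lt_of_lt_of_le hx (hr h))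
  let K : Set Klein := {x | ‖(x : E3)‖ ≤ r n}
  have hK : IsCompact K := by
    rw [Topology.IsInducing.subtypeVal.isCompact_iff]
    have : (Subtype.val '' K : Set E3) = Metric.closedBall 0 (r n) := by
      ext x
      simp only [K, Set.mem_image, Set.mem_ofPred_eq, mem_closedBall_zero_iff]
      constructor
      · rintro ⟨y, hy, rfl⟩; exact hy
      · intro h; exact ⟨⟨x, mem_ball_zero_iff.2 (h.trans_lt (hr1 n))⟩, h, rfl⟩
    rw [this]
    exact isCompact_closedBall _ _
  have hcov : (⋃ g : deckGroup p, g.1 '' K) = Set.univ := by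
    refine Set.eq_univ_of_forall fun x => ?_
    obtain ⟨y, hy, hyx⟩ := hn (Set.mem_univ (p x))
    obtain ⟨g, hg⟩ := exists_deck hp hyx
    exact Set.mem_iUnion.2 ⟨g, y, (show ‖(y : E3)‖ < r n from hy).le, hg⟩
  have hcpt : IsCompact (Set.univ : Set Klein) := by
    rw [← hcov]
    exact isCompact_iUnion fun g => hK.image g.1.continuous
  have hball : IsCompact (Metric.ball (0 : E3) 1) := by
    have := hcpt.image continuous_subtype_val
    rwa [Set.image_univ, Subtype.range_coe] at this
  rcases isClopen_iff.1 ⟨hball.isClosed, Metric.isOpen_ball⟩ with h | h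
  · exact Set.notMem_empty 0 (h ▸ Metric.mem_ball_self one_pos)
  · obtain ⟨x, hx⟩ := exists_norm_eq E3 (zero_le_one' ℝ)
    have : x ∈ Metric.ball (0 : E3) 1 := h ▸ Set.mem_univ x
    rw [mem_ball_zero_iff, hx] at this
    exact lt_irrefl _ this

/-- The linear action of the deck group on Minkowski space by Lorentz transformations. -/
def lorentzRep (hp : IsHyperbolicCover p) : Representation ℝ (deckGroup p) Mink where
  toFun g := (exists_lorentz hp g.2).choose
  map_one' := lorentz_ext isOpen_univ Set.univ_nonempty fun x _ =>
    (exists_lorentz hp (1 : deckGroup p).2).choose_spec.2 x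
  map_mul' g h := lorentz_ext isOpen_univ Set.univ_nonempty fun x _ => by
    rw [Module.End.mul_apply, (exists_lorentz hp h.2).choose_spec.2,
      (exists_lorentz hp g.2).choose_spec.2]
    exact (exists_lorentz hp (g * h).2).choose_spec.2 x

variable (hp : IsHyperbolicCover p)
include hp

theorem lorentzRep_toHyperboloid (g : deckGroup p) (x : Klein) :
    lorentzRep hp g (toHyperboloid x) = toHyperboloid (g.1 x) :=
  (exists_lorentz hp g.2).choose_spec.2 x

theorem minkForm_lorentzRep (g : deckGroup p) (x y : Mink) :
    minkForm (lorentzRep hp g x) (lorentzRep hp g y) = minkForm x y :=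
  (exists_lorentz hp g.2).choose_spec.1 x y

theorem continuous_lorentzRep (g : deckGroup p) : Continuous (lorentzRep hp g) :=
  LinearMap.continuous_of_finiteDimensional _

theorem lorentzRep_inv_apply_apply (g : deckGroup p) (x : Mink) :
    lorentzRep hp g⁻¹ (lorentzRep hp g x) = x := by
  rw [← Module.End.mul_apply, ← map_mul, inv_mul_cancel, map_one, Module.End.one_apply]

/-- A future directed timelike vector stays so, and its projection moves by the deck
transformation. -/
theorem lorentzRep_futureCone (g : deckGroup p) {x : Mink} (hx : x ∈ futureCone) :
    lorentzRep hp g x ∈ futureCone ∧ toKlein (lorentzRep hp g x) = g.1 (toKlein x) := by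
  obtain ⟨c, hc, h⟩ := toHyperboloid_toKlein hx
  have h1 : lorentzRep hp g x = c⁻¹ • toHyperboloid (g.1 (toKlein x)) := by
    rw [← lorentzRep_toHyperboloid hp, h, map_smul, smul_smul, inv_mul_cancel₀ hc.ne', one_smul]
  rw [h1, toKlein_smul (inv_pos.2 hc), toKlein_toHyperboloid]
  refine ⟨?_, rfl⟩
  have h2 : ‖_‖ < _ := toHyperboloid_mem_futureCone (g.1 (toKlein x))
  change ‖_ • _‖ < _ * _
  rw [norm_smul, Real.norm_of_nonneg (inv_pos.2 hc).le]
  exact mul_lt_mul_of_pos_left h2 (inv_pos.2 hc)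

/-- Nonzero causal vectors directed to the future are mapped to such vectors. -/
theorem lorentzRep_causal (g : deckGroup p) {x : Mink} (hx : ‖x.1‖ ≤ x.2) (h0 : 0 < x.2) :
    ‖(lorentzRep hp g x).1‖ ≤ (lorentzRep hp g x).2 ∧ 0 < (lorentzRep hp g x).2 := by
  set y := lorentzRep hp g x with hy
  set u := toHyperboloid ⟨0, Metric.mem_ball_self one_pos⟩
  have hu : u ∈ futureCone := toHyperboloid_mem_futureCone _
  have h1 : minkForm y y ≤ 0 := by
    rw [hy, minkForm_lorentzRep, minkForm_self]
    have := pow_le_pow_left₀ (norm_nonneg _) hx 2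
    linarith
  have h2 : ‖y.1‖ ≤ |y.2| := by
    rw [minkForm_self] at h1
    exact le_of_sq_le_sq (by rw [sq_abs]; linarith) (abs_nonneg _)
  have h3 : 0 < y.2 := by
    refine pos_of_minkForm_neg (lorentzRep_futureCone hp g hu).1 h2 ?_
    rw [hy, minkForm_lorentzRep]
    exact minkForm_neg hu hx h0
  exact ⟨by rwa [abs_of_pos h3] at h2, h3⟩

theorem lorentzRep_lightCone (g : deckGroup p) {x : Mink} (hx : x ∈ lightCone) :
    lorentzRep hp g x ∈ lightCone :=
  ⟨(minkForm_lorentzRep hp g x x).trans hx.1,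
    (lorentzRep_causal hp g (norm_eq_of_mem_lightCone hx).le hx.2).2⟩

/-! ### Action on the sphere at infinity -/

/-- The extension of a deck transformation to the compactification. -/
def deckExtension (g : deckGroup p) (x : ClosedKlein) : ClosedKlein :=
  ⟨radialProj (lorentzRep hp g ((x : E3), 1)), radialProj_mem_closedBall
    (lorentzRep_causal hp g (x := ((x : E3), 1)) (mem_closedBall_zero_iff.1 x.2) one_pos).1⟩

/-- The extension is induced by the projective action on future directed causal vectors. -/
theorem deckExtension_eq (g : deckGroup p) {w : Mink} (h0 : 0 < w.2)
    {x : ClosedKlein} (hx : (x : E3) = radialProj w) :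
    (deckExtension hp g x : E3) = radialProj (lorentzRep hp g w) := by
  conv_rhs => rw [← smul_radialProj h0.ne', map_smul, radialProj_smul h0.ne', ← hx]
  rfl

theorem continuous_deckExtension (g : deckGroup p) : Continuous (deckExtension hp g) := by
  refine Continuous.subtype_mk (continuous_iff_continuousAt.2 fun x => ?_) _
  have h := (lorentzRep_causal hp g (x := ((x : E3), 1)) (mem_closedBall_zero_iff.1 x.2) one_pos).2
  exact ContinuousAt.comp (f := fun x : ClosedKlein => lorentzRep hp g ((x : E3), 1))
    (continuousAt_radialProj h)
    ((continuous_lorentzRep hp g).comp (by fun_prop)).continuousAt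

theorem deckExtension_inv (g : deckGroup p) (x : ClosedKlein) :
    deckExtension hp g⁻¹ (deckExtension hp g x) = x := by
  have h := lorentzRep_causal hp g (x := ((x : E3), 1)) (mem_closedBall_zero_iff.1 x.2) one_pos
  refine Subtype.ext ?_
  rw [deckExtension_eq hp g⁻¹ h.2 rfl, lorentzRep_inv_apply_apply, radialProj_mk_one]

/-- The extension of a deck transformation to the compactification, as a homeomorphism. -/
def deckExtensionHomeo (g : deckGroup p) : ClosedKlein ≃ₜ ClosedKlein where
  toFun := deckExtension hp g
  invFun := deckExtension hp g⁻¹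
  left_inv := deckExtension_inv hp g
  right_inv x := by simpa using deckExtension_inv hp g⁻¹ x
  continuous_toFun := continuous_deckExtension hp g
  continuous_invFun := continuous_deckExtension hp g⁻¹

theorem extends_deckExtensionHomeo (g : deckGroup p) :
    Extends (deckExtensionHomeo hp g) g.1 := by
  intro x
  have h := (toHyperboloid_spec x).1.2
  have h1 := deckExtension_eq hp g h (x := ⟨x, Metric.ball_subset_closedBall x.2⟩)
    (toHyperboloid_spec x).2.symm
  rw [lorentzRep_toHyperboloid, (toHyperboloid_spec _).2] at h1
  exact h1

/-- A nontrivial deck transformation has at most two fixed points on the sphere at infinity. Indeed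
a Lorentz transformation fixing three lines on the light cone fixes their vectors, as it preserves
the nonzero products of the vectors. Then it fixes a timelike vector. -/
theorem finite_fixed_ideal_points {g : deckGroup p} (hg : g ≠ 1) :
    {x : E3 | ‖x‖ = 1 ∧ radialProj (lorentzRep hp g (x, 1)) = x}.Finite := by
  by_contra hinf
  obtain ⟨t, ht, htc⟩ := Set.Infinite.exists_subset_card_eq hinf 3
  obtain ⟨x, y, z, hxy, hxz, hyz, rfl⟩ := Finset.card_eq_three.1 htc
  have hx := ht (by simp : x ∈ (({x, y, z} : Finset E3) : Set E3))
  have hy := ht (by simp : y ∈ (({x, y, z} : Finset E3) : Set E3))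
  have hz := ht (by simp : z ∈ (({x, y, z} : Finset E3) : Set E3))
  have eig : ∀ w : E3, ‖w‖ = 1 ∧ radialProj (lorentzRep hp g (w, 1)) = w →
      ∃ c : ℝ, 0 < c ∧ lorentzRep hp g (w, 1) = c • ((w, 1) : Mink) := by
    rintro w ⟨hw1, hw2⟩
    have h := (lorentzRep_causal hp g (x := (w, 1)) hw1.le one_pos).2
    refine ⟨_, h, ?_⟩
    conv_lhs => rw [← smul_radialProj h.ne', hw2]
  have neg : ∀ v w : E3, ‖v‖ = 1 → ‖w‖ = 1 → v ≠ w → minkForm (v, 1) (w, 1) ≠ 0 := by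
    intro v w hv hw hvw h
    refine hvw ((inner_eq_one_iff_of_norm_eq_one (𝕜 := ℝ) hv hw).1 ?_)
    simp only [minkForm] at h
    linarith
  have prod : ∀ v w : E3, ‖v‖ = 1 → ‖w‖ = 1 → v ≠ w → ∀ c d : ℝ,
      lorentzRep hp g (v, 1) = c • ((v, 1) : Mink) →
      lorentzRep hp g (w, 1) = d • ((w, 1) : Mink) → c * d = 1 := by
    intro v w hv hw hvw c d hc hd
    have h := minkForm_lorentzRep hp g (v, 1) (w, 1)
    rw [hc, hd, ← minkBilin_apply, map_smul, map_smul, LinearMap.smul_apply, smul_eq_mul,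
      smul_eq_mul, minkBilin_apply, ← mul_assoc] at h
    exact mul_right_cancel₀ (neg v w hv hw hvw) (by linarith)
  obtain ⟨a, ha, hax⟩ := eig x hx
  obtain ⟨b, hb, hby⟩ := eig y hy
  obtain ⟨c, hc, hcz⟩ := eig z hz
  have hab := prod x y hx.1 hy.1 hxy a b hax hby
  have hac := prod x z hx.1 hz.1 hxz a c hax hcz
  have hbc := prod y z hy.1 hz.1 hyz b c hby hcz
  have ha1 : a = 1 := by
    have h1 : b = c := mul_left_cancel₀ ha.ne' (hab.trans hac.symm)
    have h2 : b = 1 := by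
      rw [← h1] at hbc
      nlinarith
    rw [h2] at hab; linarith
  have hb1 : b = 1 := by rw [ha1] at hab; linarith
  -- The sum of two fixed null vectors is a fixed timelike vector.
  have hfix : lorentzRep hp g ((x, 1) + (y, 1)) = ((x, 1) + (y, 1) : Mink) := by
    rw [map_add, hax, hby, ha1, hb1, one_smul, one_smul]
  have hcone : ((x, 1) + (y, 1) : Mink) ∈ futureCone := by
    change ‖x + y‖ < 1 + 1
    have h1 : ‖x + y‖ ^ 2 < 2 ^ 2 := by
      have h2 : inner ℝ x y < 1 := by
        refine lt_of_le_of_ne ?_ fun h => hxy ((inner_eq_one_iff_of_norm_eq_one hx.1 hy.1).1 h)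
        simpa [hx.1, hy.1] using real_inner_le_norm x y
      rw [norm_add_sq_real, hx.1, hy.1]
      linarith
    have := lt_of_pow_lt_pow_left₀ 2 (by norm_num) h1
    linarith
  have h := (lorentzRep_futureCone hp g hcone).2
  rw [hfix] at h
  exact hg (deck_ext_of_eq hp (x := toKlein ((x, 1) + (y, 1))) h.symm)

omit hp in
theorem infinite_sphere : {x : E3 | ‖x‖ = 1}.Infinite := by
  have h1 : IsPreconnected (Metric.sphere (0 : E3) 1) := by
    refine isPreconnected_sphere ?_ _ _
    rw [← Module.finrank_eq_rank]
    simp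
  have h2 : (Metric.sphere (0 : E3) 1).Nontrivial := by
    obtain ⟨x, hx⟩ := exists_norm_eq E3 (zero_le_one' ℝ)
    refine ⟨x, by simpa, -x, by simpa, fun h => ?_⟩
    have h0 : (2 : ℝ) • x = 0 := by rw [two_smul]; nth_rewrite 1 [h]; exact neg_add_cancel x
    rw [(smul_eq_zero_iff_right two_ne_zero).1 h0, norm_zero] at hx
    exact zero_ne_one hx
  have := h1.infinite_of_nontrivial h2
  simpa [Metric.sphere] using this

/-- There is a point at infinity fixed by none of finitely many nontrivial deck transformations. -/
theorem exists_generic_ideal_point {S : Set (deckGroup p)} (hS : S.Finite) :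
    ∃ ξ : E3, ‖ξ‖ = 1 ∧ ∀ g ∈ S, g ≠ 1 → radialProj (lorentzRep hp g (ξ, 1)) ≠ ξ := by
  have hfin : (⋃ g ∈ S \ {1},
      {x : E3 | ‖x‖ = 1 ∧ radialProj (lorentzRep hp g (x, 1)) = x}).Finite :=
    hS.sdiff.biUnion fun g hg => finite_fixed_ideal_points hp hg.2
  obtain ⟨ξ, hξ, hξ'⟩ := (infinite_sphere.sdiff hfin).nonempty
  refine ⟨ξ, hξ, fun g hg hg1 h => hξ' ?_⟩
  exact Set.mem_biUnion (x := g) ⟨hg, hg1⟩ ⟨hξ, h⟩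

end Deck

/-! ### Lifted simplices and simplexwise linear extension -/

section Lifts

variable {M : Type*} [MetricSpace M] {p : Klein → M} (hp : IsHyperbolicCover p)
  (T : Triangulation M)

include hp in
theorem exists_isLift (i : Fin T.n) (a : Tet) {x : Klein} (h : p x = T.char i a) :
    ∃ s : C(Tet, Klein), T.IsLift p i s ∧ s a = x := by
  obtain ⟨s, ⟨hs, hps⟩, -⟩ := hp.isCoveringMap.existsUnique_continuousMap_lifts (T.char i) a x h
  exact ⟨s, fun y => congrFun hps y, hs⟩

variable {T}

include hp in
theorem isLift_eq {i : Fin T.n} {s s' : C(Tet, Klein)} (hs : T.IsLift p i s)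
    (hs' : T.IsLift p i s') {a : Tet} (h : s a = s' a) : s = s' :=
  DFunLike.coe_injective (hp.isCoveringMap.eq_of_comp_eq s.continuous s'.continuous
    (funext fun y => (hs y).trans (hs' y).symm) a h)

theorem isLift_deck {i : Fin T.n} {s : C(Tet, Klein)} (hs : T.IsLift p i s) (g : deckGroup p) :
    T.IsLift p i ((g.1 : C(Klein, Klein)).comp s) :=
  fun x => (p_deck g (s x)).trans (hs x)

include hp in
theorem exists_deck_of_isLift {i : Fin T.n} {s s' : C(Tet, Klein)} (hs : T.IsLift p i s)
    (hs' : T.IsLift p i s') : ∃ g : deckGroup p, ∀ a, s' a = g.1 (s a) := by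
  let a : Tet := stdSimplex.vertex 0
  obtain ⟨g, hg⟩ := exists_deck hp ((hs a).trans (hs' a).symm)
  refine ⟨g, fun b => ?_⟩
  have := isLift_eq hp hs' (isLift_deck hs g) (a := a) hg.symm
  rw [this]; rfl

omit [MetricSpace M] in
theorem exists_char_eq [TopologicalSpace M] (T : Triangulation M) (m : M) :
    ∃ i a, m = T.char i a := by
  obtain ⟨q, rfl⟩ := T.homeo.surjective m
  obtain ⟨⟨i, a⟩, rfl⟩ := Quot.exists_rep q
  exact ⟨i, a, rfl⟩

theorem stdSimplex_map_perm (e : Equiv.Perm (Fin 4)) (y : Tet) (m : Fin 4) :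
    stdSimplex.map e y (e m) = y m := by
  rw [stdSimplex.map_coe, FunOnFinite.linearMap_apply_apply]
  simp [Finset.sum_filter]

theorem isPreconnected_face (k : Fin 4) : IsPreconnected {y : Tet | y k = 0} := by
  rw [← Topology.IsInducing.subtypeVal.isPreconnected_image]
  have : (Subtype.val '' {y : Tet | y k = 0} : Set (Fin 4 → ℝ)) =
      stdSimplex ℝ (Fin 4) ∩ {y | LinearMap.proj (R := ℝ) (φ := fun _ : Fin 4 => ℝ) k y = 0} := by
    ext y
    exact ⟨fun ⟨z, hz, h⟩ => h ▸ ⟨z.2, hz⟩, fun h => ⟨⟨y, h.1⟩, h.2, rfl⟩⟩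
  rw [this]
  exact ((convex_stdSimplex ℝ (Fin 4)).inter
    (convex_hyperplane (LinearMap.isLinear _) 0)).isPreconnected

include hp in
/-- Lifts of two tetrahedra with a common point in paired faces agree on the paired faces. -/
theorem lift_face_eq {a b : Fin T.n × Tet} {k : Fin 4} (ha : a.2 k = 0)
    (hb1 : b.1 = T.pairing.adj a.1 k) (hb : ∀ m, b.2 (T.pairing.perm a.1 k m) = a.2 m)
    {s s' : C(Tet, Klein)} (hs : T.IsLift p a.1 s) (hs' : T.IsLift p b.1 s')
    (h : s a.2 = s' b.2) {m : Fin 4} (hm : m ≠ k) :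
    s (stdSimplex.vertex m) = s' (stdSimplex.vertex (T.pairing.perm a.1 k m)) := by
  let e := T.pairing.perm a.1 k
  have hτ : Continuous (stdSimplex.map (S := ℝ) e) := stdSimplex.continuous_map _
  have hrel : ∀ y : Tet, y k = 0 → p (s y) = p (s' (stdSimplex.map e y)) := by
    intro y hy
    rw [hs y, hs' (stdSimplex.map e y)]
    exact congrArg T.homeo (Quot.sound ⟨k, hy, hb1, fun m => stdSimplex_map_perm e y m⟩)
  have hab : stdSimplex.map e a.2 = b.2 := by
    refine stdSimplex.ext (funext fun m => ?_)
    obtain ⟨m, rfl⟩ := e.surjective m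
    exact (stdSimplex_map_perm e a.2 m).trans (hb m).symm
  have heq := hp.isCoveringMap.eqOn_of_comp_eqOn (isPreconnected_face k)
    s.continuous.continuousOn (s'.continuous.comp hτ).continuousOn hrel ha
    (by simp only [Function.comp_apply, hab, h])
  have hvm : (stdSimplex.vertex m : Tet) ∈ {y : Tet | y k = 0} := by
    change (Pi.single m (1 : ℝ) : Fin 4 → ℝ) k = 0
    exact Pi.single_eq_of_ne (Ne.symm hm) _
  have := heq hvm
  rwa [Function.comp_apply, stdSimplex.map_vertex] at this

variable {E : Type*} [AddCommGroup E] [Module ℝ E]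

include hp in
/-- The value at a point of the affine interpolation of vertex data does not depend on the
lifted simplex used. -/
theorem sum_lift_eq (U : Klein → E) {i j : Fin T.n} {s s' : C(Tet, Klein)}
    (hs : T.IsLift p i s) (hs' : T.IsLift p j s') {a b : Tet} (h : s a = s' b) :
    ∑ k, a k • U (s (stdSimplex.vertex k)) = ∑ k, b k • U (s' (stdSimplex.vertex k)) := by
  have hchar : T.char i a = T.char j b := by rw [← hs a, h, hs' b]
  have hgen := Quot.eqvGen_exact (T.homeo.injective hchar)
  suffices H : ∀ x y : Fin T.n × Tet, Relation.EqvGen T.pairing.Rel x y →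
      ∀ s s' : C(Tet, Klein), T.IsLift p x.1 s → T.IsLift p y.1 s' → s x.2 = s' y.2 →
      ∑ k, x.2 k • U (s (stdSimplex.vertex k)) = ∑ k, y.2 k • U (s' (stdSimplex.vertex k)) from
    H _ _ hgen s s' hs hs' h
  clear h hs hs' hchar hgen
  intro x y hxy
  induction hxy with
  | rel x y hrel =>
    intro s s' hs hs' h
    obtain ⟨k, hk, hb1, hb⟩ := hrel
    rw [← Equiv.sum_comp (T.pairing.perm x.1 k) (fun m => y.2 m • U (s' (stdSimplex.vertex m)))]
    refine Finset.sum_congr rfl fun m _ => ?_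
    -- The vertex opposite to the face need not correspond, but its coefficient vanishes.
    by_cases hm : m = k
    · rw [hb, hm, hk, zero_smul, zero_smul]
    · rw [hb, lift_face_eq hp hk hb1 hb hs hs' h hm]
  | refl x =>
    intro s s' hs hs' h
    rw [isLift_eq hp hs hs' h]
  | symm x y _ ih =>
    intro s s' hs hs' h
    exact (ih s' s hs' hs h.symm).symm
  | trans x y z hxy _ ih1 ih2 =>
    intro s s' hs hs' h
    have : p (s x.2) = T.char y.1 y.2 :=
      (hs x.2).trans (congrArg T.homeo (Quot.eqvGen_sound hxy))
    obtain ⟨s'', hs'', h''⟩ := exists_isLift hp T y.1 y.2 this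
    exact (ih1 s s'' hs hs'' h''.symm).trans (ih2 s'' s' hs'' hs' (h''.trans h))

variable (T)

include hp in
theorem exists_isLift_through (x : Klein) :
    ∃ (i : Fin T.n) (s : C(Tet, Klein)) (a : Tet), T.IsLift p i s ∧ s a = x := by
  obtain ⟨i, a, h⟩ := exists_char_eq T (p x)
  obtain ⟨s, hs, hsa⟩ := exists_isLift hp T i a h
  exact ⟨i, s, a, hs, hsa⟩

/-- The simplexwise linear extension of the restriction of `U` to the vertices of the induced
triangulation of the universal cover: on each lifted simplex it interpolates affinely, in terms of
barycentric coordinates. -/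
def linearExt (U : Klein → E) (x : Klein) : E :=
  let s := (exists_isLift_through hp T x).choose_spec.choose
  let a := (exists_isLift_through hp T x).choose_spec.choose_spec.choose
  ∑ k, a k • U (s (stdSimplex.vertex k))

theorem linearExt_lift (U : Klein → E) {i : Fin T.n} {s : C(Tet, Klein)} (hs : T.IsLift p i s)
    (a : Tet) : linearExt hp T U (s a) = ∑ k, a k • U (s (stdSimplex.vertex k)) := by
  have h := (exists_isLift_through hp T (s a)).choose_spec.choose_spec.choose_spec
  exact sum_lift_eq hp U h.1 hs h.2

theorem sum_vertex_smul (u : Fin 4 → E) (k : Fin 4) :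
    ∑ m, (stdSimplex.vertex k : Tet) m • u m = u k := by
  rw [Finset.sum_eq_single k]
  · change (Pi.single k (1 : ℝ) : Fin 4 → ℝ) k • u k = u k
    rw [Pi.single_eq_same, one_smul]
  · intro m _ hm
    change (Pi.single k (1 : ℝ) : Fin 4 → ℝ) m • u m = 0
    rw [Pi.single_eq_of_ne hm, zero_smul]
  · simp

theorem linearExt_vertex (U : Klein → E) {i : Fin T.n} {s : C(Tet, Klein)} (hs : T.IsLift p i s)
    (k : Fin 4) : linearExt hp T U (s (stdSimplex.vertex k)) = U (s (stdSimplex.vertex k)) := by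
  rw [linearExt_lift hp T U hs, sum_vertex_smul]

theorem linearExt_equivariant {U : Klein → E} {g : deckGroup p} {A : E →ₗ[ℝ] E}
    (hU : ∀ x, U (g.1 x) = A (U x)) (x : Klein) :
    linearExt hp T U (g.1 x) = A (linearExt hp T U x) := by
  obtain ⟨i, s, a, hs, rfl⟩ := exists_isLift_through hp T x
  have h := linearExt_lift hp T U (isLift_deck hs g) a
  rw [linearExt_lift hp T U hs, map_sum]
  refine h.trans (Finset.sum_congr rfl fun k _ => ?_)
  rw [map_smul, ← hU]; rfl

theorem linearExt_mem {U : Klein → E} {C : Set E} (hC : Convex ℝ C) (hU : ∀ x, U x ∈ C)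
    (x : Klein) : linearExt hp T U x ∈ C := by
  obtain ⟨i, s, a, hs, rfl⟩ := exists_isLift_through hp T x
  rw [linearExt_lift hp T U hs]
  exact hC.sum_mem (fun k _ => a.2.1 k) a.2.2 fun k _ => hU _

include hp in
/-- A function on the universal cover, possibly with parameters, is continuous if it is so on each
lifted simplex: by compactness, an ultrafilter converging to a point eventually lives on one
lifted simplex through this point. -/
theorem continuous_of_lifts {Y Z : Type*} [TopologicalSpace Y] [TopologicalSpace Z]
    {f : Y × Klein → Z}
    (h : ∀ (i : Fin T.n) (s : C(Tet, Klein)), T.IsLift p i s →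
      Continuous fun q : Y × Tet => f (q.1, s q.2)) : Continuous f := by
  choose i a hia using fun x : Klein => exists_char_eq T (p x)
  rw [continuous_iff_ultrafilter]
  intro x 𝒰 h𝒰
  obtain ⟨⟨j, b⟩, -, hjb⟩ := isCompact_univ.ultrafilter_le_nhds
    (𝒰.map fun q => (i q.2, a q.2)) (by simp)
  have htend : Filter.Tendsto (fun q : Y × Klein => (i q.2, a q.2)) 𝒰 (𝓝 (j, b)) := hjb
  have hj : ∀ᶠ q in (𝒰 : Filter (Y × Klein)), i q.2 = j :=
    ((continuous_fst.tendsto _).comp htend).eventually_mem ((isOpen_discrete {j}).mem_nhds rfl)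
  have hb : Filter.Tendsto (fun q : Y × Klein => a q.2) 𝒰 (𝓝 b) :=
    (continuous_snd.tendsto _).comp htend
  have h1 : Filter.Tendsto Prod.fst (𝒰 : Filter (Y × Klein)) (𝓝 x.1) :=
    (continuous_fst.tendsto x).mono_left h𝒰
  have h2 : Filter.Tendsto Prod.snd (𝒰 : Filter (Y × Klein)) (𝓝 x.2) :=
    (continuous_snd.tendsto x).mono_left h𝒰
  have hpj : ∀ᶠ q in (𝒰 : Filter (Y × Klein)), p q.2 = T.char j (a q.2) := by
    filter_upwards [hj] with q hq
    rw [← hq]; exact hia q.2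
  have hpx : p x.2 = T.char j b :=
    tendsto_nhds_unique_of_eventuallyEq
      ((hp.isCoveringMap.continuous.tendsto _).comp h2)
      (((T.char j).continuous.tendsto _).comp hb) hpj
  obtain ⟨s, hs, hsb⟩ := exists_isLift hp T j b hpx
  have hsa : Filter.Tendsto (fun q : Y × Klein => s (a q.2)) 𝒰 (𝓝 x.2) :=
    hsb ▸ (s.continuous.tendsto b).comp hb
  obtain ⟨V, hV, hxV, hinj⟩ := hp.isCoveringMap.isLocalHomeomorph.isLocallyInjective x.2
  have heq : ∀ᶠ q in (𝒰 : Filter (Y × Klein)), s (a q.2) = q.2 := by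
    filter_upwards [hpj, hsa.eventually_mem (hV.mem_nhds hxV),
      h2.eventually_mem (hV.mem_nhds hxV)] with q hq hq1 hq2
    exact hinj hq1 hq2 ((hs _).trans hq.symm)
  have hlim := ((h j s hs).tendsto (x.1, b)).comp (h1.prodMk_nhds hb)
  rw [hsb] at hlim
  refine hlim.congr' ?_
  filter_upwards [heq] with q hq
  simp only [Function.comp_apply, hq]

theorem continuous_linearExt {Y : Type*} [TopologicalSpace Y] {U : Y → Klein → Mink}
    (hU : ∀ x, Continuous fun t => U t x) :
    Continuous fun q : Y × Klein => linearExt hp T (U q.1) q.2 := by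
  refine continuous_of_lifts hp T fun i s hs => ?_
  simp only [linearExt_lift hp T _ hs]
  refine continuous_finsetSum _ fun k _ => ?_
  have h1 : Continuous fun q : Y × Tet => q.2 k :=
    (continuous_apply k).comp (continuous_subtype_val.comp continuous_snd)
  have h2 : Continuous fun q : Y × Tet => U q.1 (s (stdSimplex.vertex k)) :=
    (hU _).comp continuous_fst
  exact h1.smul h2

theorem smoothOn_radialProj_sum {S : Set Tet} {u : Fin 4 → Mink}
    (h : ∀ x ∈ S, 0 < (∑ k, x k • u k).2) :
    SmoothOn S fun x => radialProj (∑ k, x k • u k) := by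
  refine ⟨fun y => radialProj (∑ k, y k • u k), ?_, fun x _ => rfl⟩
  have hlin : ContDiff ℝ ∞ fun y : Fin 4 → ℝ => ∑ k, y k • u k :=
    ContDiff.sum fun k _ => (contDiff_apply ℝ ℝ k).smul contDiff_const
  refine ContDiffOn.smul (ContDiffOn.inv hlin.snd.contDiffOn ?_) hlin.fst.contDiffOn
  rintro _ ⟨x, hx, rfl⟩
  exact (h x hx).ne'

end Lifts

/-! ### Equivariant markings which are injective on simplices -/

/-- In an infinite group, finitely many elements can be chosen with all their quotients outside a
given finite set. -/
theorem exists_quotients_notMem {G ι : Type*} [Group G] [Infinite G] {A : Set G} (hA : A.Finite)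
    (V : Finset ι) : ∃ h : ι → G, ∀ v ∈ V, ∀ w ∈ V, v ≠ w → h v * (h w)⁻¹ ∉ A := by
  classical
  induction V using Finset.induction_on with
  | empty => exact ⟨fun _ => 1, by simp⟩
  | insert v V hv ih =>
    obtain ⟨h, hh⟩ := ih
    have hfin : (⋃ w ∈ V, ((fun a => a * h w) '' A ∪ (fun a => a⁻¹ * h w) '' A)).Finite :=
      V.finite_toSet.biUnion fun w _ => (hA.image _).union (hA.image _)
    obtain ⟨c, hc⟩ := hfin.infinite_compl.nonempty
    have hc1 : ∀ w ∈ V, c * (h w)⁻¹ ∉ A := fun w hw ha =>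
      hc (Set.mem_biUnion (x := w) hw (Or.inl ⟨_, ha, by simp⟩))
    have hc2 : ∀ w ∈ V, h w * c⁻¹ ∉ A := fun w hw ha =>
      hc (Set.mem_biUnion (x := w) hw (Or.inr ⟨_, ha, by simp⟩))
    have hne : ∀ w ∈ V, w ≠ v := fun w hw h => hv (h ▸ hw)
    refine ⟨Function.update h v c, fun x hx y hy hxy => ?_⟩
    rcases Finset.mem_insert.1 hx with rfl | hx' <;> rcases Finset.mem_insert.1 hy with rfl | hy'
    · exact absurd rfl hxy
    · rw [Function.update_self, Function.update_of_ne (hne y hy')]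
      exact hc1 y hy'
    · rw [Function.update_self, Function.update_of_ne (hne x hx')]
      exact hc2 x hx'
    · rw [Function.update_of_ne (hne x hx'), Function.update_of_ne (hne y hy')]
      exact hh x hx' y hy' hxy

section Marking

variable {M : Type*} [MetricSpace M] {p : Klein → M} (hp : IsHyperbolicCover p)
  {T : Triangulation M}
include hp

/-- If no edge of the triangulation is a null-homotopic loop, then lifted simplices have distinct
vertices. -/
theorem lift_vertex_injective (hT : T.EdgesEssential) {i : Fin T.n} {s : C(Tet, Klein)}
    (hs : T.IsLift p i s) {a b : Fin 4} (hab : a ≠ b) :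
    s (stdSimplex.vertex a) ≠ s (stdSimplex.vertex b) := by
  intro h
  have h' : T.char i (stdSimplex.vertex a) = T.char i (stdSimplex.vertex b) := by
    rw [← hs, h, hs]
  refine hT i a b hab h' ?_
  let γ : Path (s (stdSimplex.vertex a)) (s (stdSimplex.vertex a)) :=
    ((stdEdge a b).map s.continuous).cast rfl h
  obtain ⟨H⟩ := SimplyConnectedSpace.paths_homotopic γ (Path.refl _)
  have H' := H.compContinuousMap ⟨p, hp.isCoveringMap.continuous⟩
  exact ⟨H'.cast (ContinuousMap.ext fun t => hs _) (ContinuousMap.ext fun t => hs _)⟩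

/-- For an equivariant marking, the quotients of marks along edges take finitely many values,
because there are finitely many simplices up to deck transformations. -/
theorem finite_edge_quotients {c : Klein → deckGroup p}
    (hc : ∀ (g : deckGroup p) x, c (g.1 x) = g * c x) :
    {q | ∃ (i : Fin T.n) (s : C(Tet, Klein)) (a b : Fin 4), T.IsLift p i s ∧
      q = (c (s (stdSimplex.vertex a)))⁻¹ * c (s (stdSimplex.vertex b))}.Finite := by
  have hl : ∀ i : Fin T.n, ∃ s : C(Tet, Klein), T.IsLift p i s := fun i => by
    obtain ⟨x, hx⟩ := hp.surjective (T.char i (stdSimplex.vertex 0))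
    obtain ⟨s, hs, -⟩ := exists_isLift hp T i _ hx
    exact ⟨s, hs⟩
  choose s₀ hs₀ using hl
  refine (Set.finite_range fun q : Fin T.n × Fin 4 × Fin 4 =>
    (c (s₀ q.1 (stdSimplex.vertex q.2.1)))⁻¹ * c (s₀ q.1 (stdSimplex.vertex q.2.2))).subset ?_
  rintro _ ⟨i, s, a, b, hs, rfl⟩
  obtain ⟨g, hg⟩ := exists_deck_of_isLift hp (hs₀ i) hs
  refine ⟨(i, a, b), ?_⟩
  simp only [hg, hc]
  group

/-- There is an equivariant marking by deck transformations which separates the vertices of each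
simplex. The lifts of a vertex of `M` are marked by the elements moving a chosen lift to them,
multiplied from the right by a sufficiently generic element depending on the vertex. -/
theorem exists_marking [CompactSpace M] (hT : T.EdgesEssential) :
    ∃ φ : Klein → deckGroup p, (∀ (g : deckGroup p) x, φ (g.1 x) = g * φ x) ∧
      ∀ (i : Fin T.n) (s : C(Tet, Klein)), T.IsLift p i s → ∀ a b : Fin 4, a ≠ b →
        φ (s (stdSimplex.vertex a)) ≠ φ (s (stdSimplex.vertex b)) := by
  choose r hr using hp.surjective
  choose c hc using fun x => exists_deck hp (hr (p x))
  have hcg : ∀ (g : deckGroup p) x, c (g.1 x) = g * c x := fun g x => by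
    refine deck_ext_of_eq hp (x := r (p x)) ?_
    rw [deck_mul_apply, hc x]
    have := hc (g.1 x)
    rwa [p_deck g] at this
  have hV : T.vertices.Finite := by
    refine (Set.finite_range fun q : Fin T.n × Fin 4 =>
      T.char q.1 (stdSimplex.vertex q.2)).subset ?_
    rintro _ ⟨i, k, rfl⟩
    exact ⟨(i, k), rfl⟩
  have := infinite_deckGroup hp
  obtain ⟨h, hh⟩ := exists_quotients_notMem (finite_edge_quotients (T := T) hp hcg) hV.toFinset
  refine ⟨fun x => c x * h (p x), fun g x => by simp only [hcg, p_deck, mul_assoc], ?_⟩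
  intro i s hs a b hab heq
  have hmem : ∀ k, p (s (stdSimplex.vertex k)) ∈ hV.toFinset := fun k =>
    hV.mem_toFinset.2 ⟨i, k, hs _⟩
  by_cases hpe : p (s (stdSimplex.vertex a)) = p (s (stdSimplex.vertex b))
  · refine lift_vertex_injective hp hT hs hab ?_
    simp only [hpe, mul_left_inj] at heq
    rw [← hc (s (stdSimplex.vertex a)), ← hc (s (stdSimplex.vertex b)), heq, hpe]
  · refine hh _ (hmem a) _ (hmem b) hpe ⟨i, s, a, b, hs, ?_⟩
    simp only at heq
    rw [eq_inv_mul_iff_mul_eq, ← mul_assoc, heq, mul_inv_cancel_right]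

end Marking

/-! ### Equivariant maps and descent to the manifold -/

section Descent

variable {M : Type*} [MetricSpace M] {p : Klein → M} (hp : IsHyperbolicCover p)
  {T : Triangulation M}

include hp in
/-- A continuous equivariant self-map of the universal cover descends to a map homotopic to the
identity, by moving along geodesics. -/
theorem exists_descent {f : Klein → Klein} (hf : Continuous f)
    (hfg : ∀ (g : deckGroup p) x, f (g.1 x) = g.1 (f x)) :
    ∃ F : C(M, M), (∀ x, F (p x) = p (f x)) ∧ F.Homotopic (ContinuousMap.id M) := by
  choose r hr using hp.surjective
  have hq := isOpenQuotientMap_cover hp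
  let w : I × Klein → Mink := fun q =>
    (1 - (q.1 : ℝ)) • toHyperboloid (f q.2) + (q.1 : ℝ) • toHyperboloid q.2
  have hw : ∀ q, w q ∈ futureCone := fun q =>
    convex_futureCone (toHyperboloid_mem_futureCone _) (toHyperboloid_mem_futureCone _)
      (sub_nonneg.2 q.1.2.2) q.1.2.1 (by ring)
  have hwc : Continuous w := by
    have h1 : Continuous fun q : I × Klein => toHyperboloid (f q.2) :=
      continuous_toHyperboloid.comp (hf.comp continuous_snd)
    have h2 : Continuous fun q : I × Klein => toHyperboloid q.2 :=
      continuous_toHyperboloid.comp continuous_snd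
    have h3 : Continuous fun q : I × Klein => (q.1 : ℝ) :=
      continuous_subtype_val.comp continuous_fst
    exact ((continuous_const.sub h3).smul h1).add (h3.smul h2)
  have hwg : ∀ (g : deckGroup p) τ x, toKlein (w (τ, g.1 x)) = g.1 (toKlein (w (τ, x))) := by
    intro g τ x
    rw [← (lorentzRep_futureCone hp g (hw (τ, x))).2]
    simp only [w, map_add, map_smul, lorentzRep_toHyperboloid, hfg]
  let H : I × M → M := fun q => p (toKlein (w (q.1, r q.2)))
  have hH : ∀ τ x, H (τ, p x) = p (toKlein (w (τ, x))) := by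
    intro τ x
    obtain ⟨g, hg⟩ := exists_deck hp (hr (p x)).symm
    simp only [H]
    rw [← hg, hwg, p_deck g]
  have hHc : Continuous H := by
    rw [← (IsOpenQuotientMap.id.prodMap hq).continuous_comp_iff]
    have : H ∘ Prod.map id p = fun q : I × Klein => p (toKlein (w q)) :=
      funext fun q => hH q.1 q.2
    rw [this]
    exact hp.isCoveringMap.continuous.comp (continuousOn_toKlein.comp_continuous hwc hw)
  have h0 : ∀ x, H (0, p x) = p (f x) := fun x => by
    rw [hH]; simp [w, toKlein_toHyperboloid]
  have h1 : ∀ m, H (1, m) = m := fun m => by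
    obtain ⟨x, rfl⟩ := hp.surjective m
    rw [hH]; simp [w, toKlein_toHyperboloid]
  refine ⟨⟨fun m => H (0, m), hHc.comp (by fun_prop)⟩, h0, ⟨⟨⟨H, hHc⟩, fun m => rfl, h1⟩⟩⟩

theorem SmoothOn.mono {S S' : Set Tet} {f : Tet → E3} (h : SmoothOn S f) (hS : S' ⊆ S) :
    SmoothOn S' f := by
  obtain ⟨F, hF, hFf⟩ := h
  exact ⟨F, hF.mono (Set.image_mono hS), fun x hx => hFf x (hS hx)⟩

theorem SmoothOn.congr {S : Set Tet} {f f' : Tet → E3} (h : SmoothOn S f)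
    (hf : ∀ x ∈ S, f' x = f x) : SmoothOn S f' := by
  obtain ⟨F, hF, hFf⟩ := h
  exact ⟨F, hF, fun x hx => (hFf x hx).trans (hf x hx).symm⟩

include hp in
theorem piecewiseSmoothInto_of_lift {N : Set M} {f : M → M} {F : Klein → Klein}
    (hf : ∀ x, p x ∈ N → f (p x) = p (F x))
    (hF : ∀ (i : Fin T.n) (s : C(Tet, Klein)), T.IsLift p i s →
      SmoothOn (T.char i ⁻¹' N) fun x => (F (s x) : E3)) :
    PiecewiseSmoothInto T p N f := by
  intro i x _
  obtain ⟨y, hy⟩ := hp.surjective (T.char i x)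
  obtain ⟨s, hs, -⟩ := exists_isLift hp T i x hy
  refine ⟨Set.univ, Filter.univ_mem, fun y => F (s y), ?_, fun z hz => ?_⟩
  · exact (hF i s hs).mono Set.inter_subset_right
  · have hz' : p (s z) ∈ N := by rw [hs]; exact hz.2
    simp only [← hs z, hf _ hz']

end Descent

/-! ### Spinning -/

section Spin

variable {M : Type*} [MetricSpace M] {p : Klein → M} (hp : IsHyperbolicCover p)
  (T : Triangulation M) (φ : Klein → deckGroup p)

/-- The equivariant map to Minkowski space which is affine on simplices and maps a vertex marked
by the deck transformation `g` to `g w`. -/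
def spinMap (w : Mink) (x : Klein) : Mink :=
  linearExt hp T (fun y => lorentzRep hp (φ y) w) x

theorem spinMap_lift (w : Mink) {i : Fin T.n} {s : C(Tet, Klein)} (hs : T.IsLift p i s) (a : Tet) :
    spinMap hp T φ w (s a) = ∑ k, a k • lorentzRep hp (φ (s (stdSimplex.vertex k))) w :=
  linearExt_lift hp T _ hs a

theorem spinMap_vertex (w : Mink) {i : Fin T.n} {s : C(Tet, Klein)} (hs : T.IsLift p i s)
    (k : Fin 4) : spinMap hp T φ w (s (stdSimplex.vertex k)) =
      lorentzRep hp (φ (s (stdSimplex.vertex k))) w :=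
  linearExt_vertex hp T _ hs k

theorem spinMap_smul (c : ℝ) (w : Mink) (x : Klein) :
    spinMap hp T φ (c • w) x = c • spinMap hp T φ w x := by
  obtain ⟨i, s, a, hs, rfl⟩ := exists_isLift_through hp T x
  simp only [spinMap_lift hp T φ _ hs, map_smul, Finset.smul_sum, smul_comm c]

theorem continuous_spinMap : Continuous fun q : Mink × Klein => spinMap hp T φ q.1 q.2 :=
  continuous_linearExt hp T fun _ => continuous_lorentzRep hp _

theorem continuous_spinMap_comp {Y : Type*} [TopologicalSpace Y] {w : Y → Mink} {f : Y → Klein}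
    (hw : Continuous w) (hf : Continuous f) : Continuous fun y => spinMap hp T φ (w y) (f y) :=
  Continuous.comp (g := fun q : Mink × Klein => spinMap hp T φ q.1 q.2)
    (f := fun y => (w y, f y)) (continuous_spinMap hp T φ) (hw.prodMk hf)

theorem spinMap_mem_futureCone {w : Mink} (hw : w ∈ futureCone) (x : Klein) :
    spinMap hp T φ w x ∈ futureCone :=
  linearExt_mem hp T convex_futureCone (fun _ => (lorentzRep_futureCone hp _ hw).1) x

theorem spinMap_causal {w : Mink} (hw : w ∈ lightCone) (x : Klein) :
    ‖(spinMap hp T φ w x).1‖ ≤ (spinMap hp T φ w x).2 ∧ 0 < (spinMap hp T φ w x).2 := by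
  have h1 : Convex ℝ {x : Mink | x ∈ Set.univ ∧ ‖x.1‖ - x.2 ≤ 0} :=
    ConvexOn.convex_le ((convexOn_univ_norm.comp_linearMap (LinearMap.fst ℝ E3 ℝ)).sub
      ((LinearMap.snd ℝ E3 ℝ).concaveOn convex_univ)) 0
  have h2 : Convex ℝ {x : Mink | 0 < x.2} :=
    convex_halfSpace_gt (LinearMap.snd ℝ E3 ℝ).isLinear 0
  have h := linearExt_mem hp T (h1.inter h2) (U := fun y => lorentzRep hp (φ y) w)
    (fun y => by
      have := lorentzRep_lightCone hp (φ y) hw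
      exact ⟨⟨trivial, by rw [norm_eq_of_mem_lightCone this, sub_self]⟩, this.2⟩) x
  exact ⟨sub_nonpos.1 h.1.2, h.2⟩

variable {φ}

theorem spinMap_equivariant (hφ : ∀ (g : deckGroup p) x, φ (g.1 x) = g * φ x) (w : Mink)
    (g : deckGroup p) (x : Klein) :
    spinMap hp T φ w (g.1 x) = lorentzRep hp g (spinMap hp T φ w x) :=
  linearExt_equivariant hp T (fun y => by rw [hφ, map_mul, Module.End.mul_apply]) x

attribute [irreducible] spinMap

/-- The spun simplices are straight. -/
theorem isStraightSimplex_spinMap {i : Fin T.n} {s : C(Tet, Klein)} (hs : T.IsLift p i s)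
    (o : Klein) :
    IsStraightSimplex
      (fun k => toKlein (spinMap hp T φ (toHyperboloid o) (s (stdSimplex.vertex k))))
      fun x => toKlein (spinMap hp T φ (toHyperboloid o) (s x)) := by
  intro x
  rw [coe_toKlein (spinMap_mem_futureCone hp T φ (toHyperboloid_mem_futureCone o) _),
    spinMap_lift hp T φ _ hs]
  simp only [spinMap_vertex hp T φ _ hs, lorentzRep_toHyperboloid, toKlein_toHyperboloid]

theorem smoothOn_spinMap (w : Mink) {i : Fin T.n} {s : C(Tet, Klein)} (hs : T.IsLift p i s)
    (h : ∀ x, 0 < (spinMap hp T φ w x).2) :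
    SmoothOn Set.univ fun x => radialProj (spinMap hp T φ w (s x)) := by
  simp only [spinMap_lift hp T φ w hs]
  exact smoothOn_radialProj_sum fun x _ => by
    rw [← spinMap_lift hp T φ w hs]; exact h _

/-- Distinct marks give distinct points at infinity if the point `ξ` is not fixed by the quotient of
the marks. -/
theorem radialProj_lorentzRep_ne {ξ : E3} (hξ : ‖ξ‖ = 1) {g h : deckGroup p}
    (hfix : radialProj (lorentzRep hp (g⁻¹ * h) (ξ, 1)) ≠ ξ) :
    radialProj (lorentzRep hp g (ξ, 1)) ≠ radialProj (lorentzRep hp h (ξ, 1)) := by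
  intro heq
  apply hfix
  have hpos : ∀ k : deckGroup p, 0 < (lorentzRep hp k (ξ, 1)).2 := fun k =>
    (lorentzRep_causal hp k (x := (ξ, 1)) hξ.le one_pos).2
  have hg := smul_radialProj (hpos g).ne'
  have hh := smul_radialProj (hpos h).ne'
  rw [map_mul, Module.End.mul_apply, ← hh, ← heq, map_smul, radialProj_smul (hpos h).ne',
    ← radialProj_smul (hpos g).ne', ← map_smul, hg, lorentzRep_inv_apply_apply, radialProj_mk_one]

end Spin

/-- A path in the Klein model running along a radius to the point `ξ` of the sphere at infinity. -/
def rayPoint (ξ : E3) (hξ : ‖ξ‖ = 1) (t : ℝ≥0) : Klein :=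
  ⟨((t : ℝ) / (t + 1)) • ξ, by
    have h : (0 : ℝ) < t + 1 := by positivity
    rw [mem_ball_zero_iff, norm_smul, hξ, mul_one, Real.norm_of_nonneg (by positivity),
      div_lt_one h]
    linarith⟩

theorem continuous_rayPoint (ξ : E3) (hξ : ‖ξ‖ = 1) : Continuous (rayPoint ξ hξ) := by
  have h1 : Continuous fun t : ℝ≥0 => (t : ℝ) := NNReal.continuous_coe
  have h2 : ∀ t : ℝ≥0, (t : ℝ) + 1 ≠ 0 := fun t => by positivity
  exact Continuous.subtype_mk ((h1.div (h1.add continuous_const) h2).smul continuous_const) _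

theorem continuous_spinMap_rayPoint {M : Type*} [MetricSpace M] {p : Klein → M}
    (hp : IsHyperbolicCover p) (T : Triangulation M) (φ : Klein → deckGroup p) (ξ : E3)
    (hξ : ‖ξ‖ = 1) :
    Continuous fun q : ℝ≥0 × Klein => spinMap hp T φ (toHyperboloid (rayPoint ξ hξ q.1)) q.2 := by
  have h : Continuous fun q : ℝ≥0 × Klein => rayPoint ξ hξ q.1 :=
    (continuous_rayPoint ξ hξ).comp continuous_fst
  exact continuous_spinMap_comp hp T φ (continuous_toHyperboloid.comp h) continuous_snd

theorem tendsto_rayPoint (ξ : E3) (hξ : ‖ξ‖ = 1) :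
    Filter.Tendsto (fun t => (rayPoint ξ hξ t : E3)) Filter.atTop (𝓝 ξ) := by
  have h : Filter.Tendsto (fun t : ℝ≥0 => 1 - ((t : ℝ) + 1)⁻¹) Filter.atTop (𝓝 (1 - 0)) :=
    tendsto_const_nhds.sub (tendsto_inv_atTop_zero.comp
      (Filter.tendsto_atTop_add_const_right _ _
        (NNReal.tendsto_coe_atTop.2 Filter.tendsto_id)))
  have h2 := h.smul_const ξ
  rw [sub_zero, one_smul] at h2
  refine h2.congr fun t => ?_
  have : (t : ℝ) + 1 ≠ 0 := by positivity
  simp only [rayPoint]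
  congr 1
  field_simp
  ring

end Spinning

open Spinning in
theorem mainTheorem5 {M : Type*} [MetricSpace M] [CompactSpace M]
    (p : Spinning.Klein → M) (hp : Spinning.IsHyperbolicCover p)
    (T : Spinning.Triangulation M) (hT : T.EdgesEssential) :
    ∃ (F : ℝ≥0 → Spinning.Klein → Spinning.Klein) (F' : Spinning.Klein → Spinning.ClosedKlein),
      -- a continuous family of piecewise smooth equivariant maps, and the limit map
      Continuous (Function.uncurry F) ∧
      (∀ t, Spinning.PiecewiseSmooth T p (fun x => (F t x : Spinning.E3))) ∧
      (∀ g, Spinning.IsDeck p g → ∀ t x, F t (g x) = g (F t x)) ∧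
      Continuous F' ∧
      Spinning.PiecewiseSmooth T p (fun x => (F' x : Spinning.E3)) ∧
      (∀ g, Spinning.IsDeck p g → ∃ G, Spinning.Extends G g ∧ ∀ x, F' (g x) = G (F' x)) ∧
      -- (1) vertices approach the sphere at infinity, and simplices map to hyperbolic tetrahedra
      (∀ v, p v ∈ T.vertices →
        Filter.Tendsto (fun t => ‖(F t v : Spinning.E3)‖) Filter.atTop (𝓝 1)) ∧
      (∀ (i : Fin T.n) (s : C(Spinning.Tet, Spinning.Klein)), T.IsLift p i s → ∀ t,
        Function.Injective (fun k : Fin 4 => F t (s (stdSimplex.vertex k))) ∧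
        Spinning.IsStraightSimplex (fun k => F t (s (stdSimplex.vertex k)))
          (fun x => F t (s x))) ∧
      -- (2) descent to piecewise smooth maps of `M` homotopic to the identity
      (∀ t, ∃ f : C(M, M), (∀ x, f (p x) = p (F t x)) ∧
        Spinning.PiecewiseSmoothInto T p Set.univ f ∧
        f.Homotopic (ContinuousMap.id M)) ∧
      -- (3) pointwise convergence
      (∀ x, Filter.Tendsto (fun t => (F t x : Spinning.E3)) Filter.atTop
        (𝓝 (F' x : Spinning.E3))) ∧
      -- (4) simplices map to ideal tetrahedra with four distinct vertices
      (∀ (i : Fin T.n) (s : C(Spinning.Tet, Spinning.Klein)), T.IsLift p i s →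
        Function.Injective (fun k : Fin 4 => F' (s (stdSimplex.vertex k))) ∧
        Spinning.IsStraightIdealSimplex (fun k => F' (s (stdSimplex.vertex k)))
          (fun x => F' (s x))) ∧
      -- (5) only vertices are sent to infinity, and descent on the complement of the 0-skeleton
      (∃ f : M → M, ContinuousOn f (T.vertices)ᶜ ∧
        Spinning.PiecewiseSmoothInto T p (T.vertices)ᶜ f ∧
        ∀ x, p x ∉ T.vertices → ∃ h : (F' x : Spinning.E3) ∈ Metric.ball (0 : Spinning.E3) 1,
          f (p x) = p ⟨F' x, h⟩) := by
  obtain ⟨φ, hφ, hφne⟩ := exists_marking hp hT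
  obtain ⟨ξ, hξ, hξfix⟩ := exists_generic_ideal_point hp (finite_edge_quotients (T := T) hp hφ)
  let W : ℝ≥0 → Klein → Mink := fun t => spinMap hp T φ (toHyperboloid (rayPoint ξ hξ t))
  let W' : Klein → Mink := spinMap hp T φ (ξ, 1)
  have hξl : ((ξ, 1) : Mink) ∈ lightCone := ⟨by rw [minkForm_self, hξ]; norm_num, one_pos⟩
  have hW : ∀ t x, W t x ∈ futureCone := fun t x =>
    spinMap_mem_futureCone hp T φ (toHyperboloid_mem_futureCone _) x
  have hW' : ∀ x, ‖(W' x).1‖ ≤ (W' x).2 ∧ 0 < (W' x).2 := spinMap_causal hp T φ hξl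
  have hWg : ∀ (g : deckGroup p) t x, toKlein (W t (g.1 x)) = g.1 (toKlein (W t x)) :=
    fun g t x => by
      rw [← (lorentzRep_futureCone hp g (hW t x)).2]
      exact congrArg _ (spinMap_equivariant hp T hφ _ g x)
  have hWg' : ∀ (g : deckGroup p) x, W' (g.1 x) = lorentzRep hp g (W' x) :=
    spinMap_equivariant hp T hφ _
  have hWc : Continuous fun q : ℝ≥0 × Klein => W q.1 q.2 :=
    continuous_spinMap_rayPoint hp T φ ξ hξ
  have hWc' : Continuous W' :=
    continuous_spinMap_comp hp T φ continuous_const continuous_id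
  have hFc : Continuous fun q : ℝ≥0 × Klein => toKlein (W q.1 q.2) :=
    continuousOn_toKlein.comp_continuous hWc fun q => hW q.1 q.2
  have hsm : ∀ t (i : Fin T.n) (s : C(Tet, Klein)), T.IsLift p i s →
      SmoothOn Set.univ fun x => (toKlein (W t (s x)) : E3) := fun t i s hs =>
    (smoothOn_spinMap hp T _ hs fun x => pos_of_mem_futureCone (hW t x)).congr
      fun x _ => coe_toKlein (hW t (s x))
  have hsm' : ∀ (i : Fin T.n) (s : C(Tet, Klein)), T.IsLift p i s →
      SmoothOn Set.univ fun x => radialProj (W' (s x)) := fun i s hs =>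
    smoothOn_spinMap hp T _ hs fun x => (hW' x).2
  -- Rescaling the vectors over the ray by their height makes them converge to a null vector.
  have hlim : ∀ x, Filter.Tendsto (fun t => (toKlein (W t x) : E3)) Filter.atTop
      (𝓝 (radialProj (W' x))) := by
    intro x
    have h1 : Filter.Tendsto (fun t => ((rayPoint ξ hξ t : E3), (1 : ℝ))) Filter.atTop
        (𝓝 (ξ, 1)) := (tendsto_rayPoint ξ hξ).prodMk_nhds tendsto_const_nhds
    have h2 := ((continuous_spinMap hp T φ).tendsto ((ξ, 1), x)).comp
      (h1.prodMk_nhds (tendsto_const_nhds (x := x)))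
    refine ((continuousAt_radialProj (hW' x).2).tendsto.comp h2).congr fun t => ?_
    rw [coe_toKlein (hW t x)]
    have h3 := (toHyperboloid_spec (rayPoint ξ hξ t)).1.2
    have h4 := smul_radialProj h3.ne'
    rw [(toHyperboloid_spec _).2] at h4
    simp only [Function.comp_apply, W]
    rw [← h4, spinMap_smul, radialProj_smul h3.ne']
  have hvtx : ∀ (i : Fin T.n) (s : C(Tet, Klein)), T.IsLift p i s → ∀ k,
      W' (s (stdSimplex.vertex k)) = lorentzRep hp (φ (s (stdSimplex.vertex k))) (ξ, 1) :=
    fun i s hs k => spinMap_vertex hp T φ _ hs k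
  have hinj' : ∀ (i : Fin T.n) (s : C(Tet, Klein)), T.IsLift p i s →
      Function.Injective fun k =>
        radialProj (lorentzRep hp (φ (s (stdSimplex.vertex k))) (ξ, 1)) := by
    intro i s hs a b h
    by_contra hab
    refine radialProj_lorentzRep_ne hp hξ (hξfix _ ⟨i, s, a, b, hs, rfl⟩ fun h1 => ?_) h
    exact hφne i s hs a b hab (inv_mul_eq_one.1 h1)
  have hcone : ∀ x, p x ∉ T.vertices → W' x ∈ futureCone := by
    intro x hx
    obtain ⟨i, s, a, hs, rfl⟩ := exists_isLift_through hp T x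
    have := spinMap_lift hp T φ (ξ, 1) hs a
    simp only [W', this]
    refine sum_lightCone_mem_futureCone (fun k => lorentzRep_lightCone hp _ hξl)
      (hinj' i s hs) fun k hk => hx ⟨i, k, ?_⟩
    rw [hs, hk]
  have hcoe : ∀ x (h : radialProj (W' x) ∈ Metric.ball (0 : E3) 1),
      toKlein (W' x) = ⟨radialProj (W' x), h⟩ := fun x h => by rw [toKlein, dif_pos h]
  refine ⟨fun t x => toKlein (W t x),
    fun x => ⟨radialProj (W' x), radialProj_mem_closedBall (hW' x).1⟩,
    ?_, ?_, ?_, ?_, ?_, fun g hg => ?_, ?_, fun i s hs t => ⟨fun a b h => ?_, ?_⟩,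
    fun t => ?_, ?_, fun i s hs => ⟨fun a b h => ?_, ?_⟩, ?_⟩
  · exact hFc
  · exact hsm
  · exact fun g hg t x => hWg ⟨g, hg⟩ t x
  · exact Continuous.subtype_mk
      (continuousOn_radialProj.comp_continuous hWc' fun x => (hW' x).2.ne') _
  · exact hsm'
  · refine ⟨deckExtensionHomeo hp ⟨g, hg⟩, extends_deckExtensionHomeo hp ⟨g, hg⟩, fun x => ?_⟩
    refine Subtype.ext ?_
    change radialProj (W' (g x)) = _
    rw [hWg' ⟨g, hg⟩ x]
    exact (deckExtension_eq hp ⟨g, hg⟩ (hW' x).2 rfl).symm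
  · rintro v ⟨i, k, hv⟩
    obtain ⟨s, hs, rfl⟩ := exists_isLift hp T i _ hv
    have h := (hlim (s (stdSimplex.vertex k))).norm
    rwa [hvtx i s hs, norm_radialProj_of_mem_lightCone (lorentzRep_lightCone hp _ hξl)] at h
  · by_contra hab
    simp only [W, spinMap_vertex hp T φ _ hs, lorentzRep_toHyperboloid,
      toKlein_toHyperboloid] at h
    exact hφne i s hs a b hab (deck_ext_of_eq hp h)
  · exact isStraightSimplex_spinMap hp T hs _
  · obtain ⟨f, hf, hfh⟩ := exists_descent hp
      (hFc.comp (f := fun x => (t, x)) (Continuous.prodMk_right t))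
      (fun g x => hWg g t x)
    exact ⟨f, hf, piecewiseSmoothInto_of_lift hp (fun x _ => hf x) fun i s hs =>
      (hsm t i s hs).mono (Set.subset_univ _), hfh⟩
  · exact hlim
  · refine hinj' i s hs ?_
    have := congrArg Subtype.val h
    simpa only [hvtx i s hs] using this
  · refine ⟨fun k => lorentzRep hp (φ (s (stdSimplex.vertex k))) (ξ, 1), fun k =>
      ⟨lorentzRep_lightCone hp _ hξl, ?_⟩, fun x => ?_⟩
    · simp only [hvtx i s hs]
    · exact congrArg radialProj (spinMap_lift hp T φ (ξ, 1) hs x)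
  · choose r hr using hp.surjective
    have hf : ∀ x, p x ∉ T.vertices → p (toKlein (W' (r (p x)))) = p (toKlein (W' x)) := by
      intro x hx
      obtain ⟨g, hg⟩ := exists_deck hp (hr (p x)).symm
      rw [← hg, hWg', (lorentzRep_futureCone hp g (hcone x hx)).2, p_deck g]
    refine ⟨fun m => p (toKlein (W' (r m))), fun m hm => ?_, ?_, fun x hx =>
      ⟨radialProj_mem_ball (hcone x hx), ?_⟩⟩
    · obtain ⟨x, rfl⟩ := hp.surjective m
      refine ContinuousAt.continuousWithinAt ?_
      rw [← (isOpenQuotientMap_cover hp).continuousAt_comp_iff]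
      have h1 : ContinuousAt (fun y => p (toKlein (W' y))) x :=
        hp.isCoveringMap.continuous.continuousAt.comp
          ((continuousOn_toKlein.continuousAt (isOpen_futureCone.mem_nhds (hcone x hm))).comp
            hWc'.continuousAt)
      refine h1.congr ?_
      filter_upwards [hWc'.continuousAt (isOpen_futureCone.mem_nhds (hcone x hm))] with y hy
      obtain ⟨g, hg⟩ := exists_deck hp (hr (p y)).symm
      simp only [Function.comp_apply]
      rw [← hg, hWg', (lorentzRep_futureCone hp g hy).2, p_deck g]
    · refine piecewiseSmoothInto_of_lift (F := fun x => toKlein (W' x)) hp (fun x hx => hf x hx)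
        fun i s hs => ?_
      refine ((hsm' i s hs).mono (Set.subset_univ _)).congr fun x hx => coe_toKlein (hcone _ ?_)
      rw [hs]
      exact hx
    · exact (hf x hx).trans (congrArg p (hcoe x _))

end
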